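/- \textbf{Termination Correspondence.} \emph{Graph transformation systems.} Graphs are finite directed multigraphs $(V,E,\mathrm{src},\mathrm{tgt})$; $\deg(v)$ is the number of edges with source $v$ plus the number of edges with target $v$. A graph typed over a type graph $TG$ is a graph $G$ with a graph morphism $\mathrm{type}_G: G\to TG$; morphisms of typed graphs preserve the typing. A graph transformation system (GTS) $\mathcal S$ consists of a type graph $TG$ and a set of rules $p=(L\xleftarrow{l}K\xrightarrow{r}R)$, where $L,K,R$ are graphs typed over $TG$ and $l,r$ are inclusions. $G\Rightarrow H$ holds if for some rule there are an injective match $m:L\to G$, a typed graph $D$ and morphisms such that $L\leftarrow K\to D$, with $m:L\to G$ and $D\to G$, and $R\leftarrow K\to D$, with $R\to H$ and $D\to H$, are both pushout squares of typed graphs (double pushout). $\mathcal S$ is terminating if there is no infinite sequence $G_0\Rightarrow G_1\Rightarrow\cdots$ of typed graphs. \emph{CHR.} Fix an infinite set of variables and a complete first-order theory $\mathcal{CT}$ of built-in constraints (with logical equality) that has a constant for every integer and binary function symbols $+,-$, proves that different integers are different, and correctly evaluates sums and differences of integers. A state $\langle\mathbb G;\mathbb B;\mathbb V\rangle$ consists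 of a multiset $\mathbb G$ of user-defined constraints, a conjunction $\mathbb B$ of built-in constraints and a set $\mathbb V$ of global variables. State equivalence $\equiv$ is the smallest equivalence relation with (1) $\langle\mathbb G;x\doteq t\wedge\mathbb B;\mathbb V\rangle\equiv\langle\mathbb G[x/t];x\doteq t\wedge\mathbb B;\mathbb V\rangle$; (2) $\langle\mathbb G;\mathbb B;\mathbb V\rangle\equiv\langle\mathbb G;\mathbb B';\mathbb V\rangle$ if $\mathcal{CT}\models\exists\bar s.\mathbb B\leftrightarrow\exists\bar s'.\mathbb B'$, where $\bar s,\bar s'$ are the variables of $\mathbb B$, $\mathbb B'$ that are neither in $\mathbb V$ nor in $\mathbb G$; (3) $\langle\mathbb G;\mathbb B;\{X\}\cup\mathbb V\rangle\equiv\langle\mathbb G;\mathbb B;\mathbb V\rangle$ if $X$ does not occur in $\mathbb G$ or $\mathbb B$; (4) $\langle\mathbb G;\bot;\mathbb V\rangle\equiv\langle\mathbb G';\bot;\mathbb V\rangle$. A rule $H_1\backslash H_2\Leftrightarrow g\mid B_c,B_b$ of a program $\mathcal P$, taken in a copy with fresh variables, gives the transitions $[\langle H_1\uplus H_2\uplus\mathbb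 G;g\wedge\mathbb B;\mathbb V\rangle]\rightarrowtail[\langle H_1\uplus B_c\uplus\mathbb G;g\wedge B_b\wedge\mathbb B;\mathbb V\rangle]$ between equivalence classes. Here fresh means that no variable of the copy occurs in $\mathbb G$ or $\mathbb V$, and that its variables outside of $H_1,H_2,g$ do not occur in $\mathbb B$ either. \emph{Encoding.} The constraint symbols are $v/2$ for the nodes $v$ and $e/3$ for the edges $e$ of $TG$. Let $\mathrm{var}$ and $\mathrm{dvar}$ assign pairwise different variables to the items of a graph. Put $\mathrm{chr}_G(\mathrm{gnd},x)=\mathrm{type}_G(x)(\mathrm{var}(x),\deg_G(x))$ and $\mathrm{chr}_G(\mathrm{kp},x)=\mathrm{type}_G(x)(\mathrm{var}(x),\mathrm{dvar}(x))$ for a node $x$, and $\mathrm{chr}_G(\cdot,x)=\mathrm{type}_G(x)(\mathrm{var}(x),\mathrm{var}(\mathrm{src}(x)),\mathrm{var}(\mathrm{tgt}(x)))$ for an edge $x$; $\mathrm{chr}(\mathrm{gnd},G)$ is the multiset of all $\mathrm{chr}_G(\mathrm{gnd},x)$. The GTS-CHR program of $\mathcal S$ consists of the simplification rules $C_L\Leftrightarrow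 C_R^u,C_R^b$, one for each rule of $\mathcal S$, with $C_L=\{\mathrm{chr}_L(\mathrm{kp},x)\mid x\in K\}\uplus\{\mathrm{chr}_L(\mathrm{gnd},x)\mid x\in L\setminus K\}$, $C_R^u=\{\mathrm{chr}_R(\mathrm{gnd},x)\mid x\in R\setminus K\}\uplus\{\mathrm{chr}_R(\mathrm{kp},e)\mid e\in E_K\}\uplus\{\mathrm{chr}_R(\mathrm{kp},v')\mid v\in V_K\}$, $C_R^b=\bigwedge_{v\in V_K}\bigl(\mathrm{var}(v)=\mathrm{var}(v')\wedge\mathrm{dvar}(v')=\mathrm{dvar}(v)-\deg_L(v)+\deg_R(v)\bigr)$, where $v'$ is a copy of $v$, of the same type and with new variables, and the items of $K$ have the same variables in $L$ and $R$. \emph{Graph invariant.} $\mathcal G(\sigma)$ holds for $\sigma=\langle\mathbb G;\mathbb B;\mathbb V\rangle$ if $\mathbb B$ is a conjunction of constraints of the forms $X=c$ and $X=Y+c_1-c_2$ with constants $c,c_1,c_2$, and there are a graph $G$ typed over $TG$ and a conjunction $B$ of constraints of the form $X=c$ such that $\langle\mathbb G;\mathbb B\wedge B;\emptyset\rangle\equiv\langle\mathrm{chr}(\mathrm{gnd},G);\top;\emptyset\rangle$.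 A program is $\mathcal G$-terminating if for no state $\sigma$ with $\mathcal G(\sigma)$ there is an infinite sequence $[\sigma]\rightarrowtail q_1\rightarrowtail q_2\rightarrowtail\cdots$. \emph{Claim.} A GTS is terminating if and only if its GTS-CHR program is $\mathcal G$-terminating. -/

import Mathlib

universe u v w

namespace GTSCHR

open CategoryTheory

/-! ### Graphs, typed graphs, graph transformation systems -/

/-- A finite directed multigraph. -/
structure Graph where
  V : Type
  E : Type
  [fintypeV : Fintype V]
  [fintypeE : Fintype E]
  src : E → V
  tgt : E → V

attribute [instance] Graph.fintypeV Graph.fintypeE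

/-- Graph morphisms. -/
structure GraphHom (G H : Graph) where
  onV : G.V → H.V
  onE : G.E → H.E
  src_comm : ∀ e, onV (G.src e) = H.src (onE e)
  tgt_comm : ∀ e, onV (G.tgt e) = H.tgt (onE e)

/-- The degree of a node: outgoing edges plus incoming edges (a loop counts twice). -/
noncomputable def Graph.deg (G : Graph) (x : G.V) : ℕ :=
  Nat.card {e : G.E // G.src e = x} + Nat.card {e : G.E // G.tgt e = x}

/-- A graph typed over the type graph `TG`. -/
structure TypedGraph (TG : Graph) extends Graph where
  type : GraphHom toGraph TG

/-- Morphisms of typed graphs: graph morphisms that preserve the typing. -/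
@[ext]
structure TypedGraph.Hom {TG : Graph} (G H : TypedGraph TG) extends
    GraphHom G.toGraph H.toGraph where
  type_onV : ∀ x, H.type.onV (onV x) = G.type.onV x
  type_onE : ∀ e, H.type.onE (onE e) = G.type.onE e

/-- The category of (finite) graphs typed over `TG`. -/
instance TypedGraph.category (TG : Graph) : Category (TypedGraph TG) where
  Hom G H := TypedGraph.Hom G H
  id G :=
    { onV := fun x => x
      onE := fun e => e
      src_comm := fun _ => rfl
      tgt_comm := fun _ => rfl
      type_onV := fun _ => rfl
      type_onE := fun _ => rfl }
  comp f g :=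
    { onV := fun x => g.onV (f.onV x)
      onE := fun e => g.onE (f.onE e)
      src_comm := fun e => by rw [f.src_comm, g.src_comm]
      tgt_comm := fun e => by rw [f.tgt_comm, g.tgt_comm]
      type_onV := fun x => by rw [g.type_onV, f.type_onV]
      type_onE := fun e => by rw [g.type_onE, f.type_onE] }

namespace TypedGraph

variable {TG : Graph} {G H : TypedGraph TG}

/-- The node part of a morphism. -/
def homV (f : G ⟶ H) : G.V → H.V := GraphHom.onV (TypedGraph.Hom.toGraphHom f)

/-- The edge part of a morphism. -/
def homE (f : G ⟶ H) : G.E → H.E := GraphHom.onE (TypedGraph.Hom.toGraphHom f)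

/-- A morphism is injective if both of its parts are. -/
def IsInjective (f : G ⟶ H) : Prop :=
  Function.Injective (homV f) ∧ Function.Injective (homE f)

end TypedGraph

open TypedGraph

/-- A graph production rule `L ← K → R`.  The inclusions `l`, `r` of the context graph are given
as injective morphisms; `L` and `R` share exactly the items of `K`. -/
structure Rule (TG : Graph) where
  L : TypedGraph TG
  K : TypedGraph TG
  R : TypedGraph TG
  l : K ⟶ L
  r : K ⟶ R
  l_inj : IsInjective l
  r_inj : IsInjective r

/-- Double-pushout transformation of `G` into `H` by the rule `p` along the match `m`. -/
def DPO {TG : Graph} (p : Rule TG) {G : TypedGraph TG} (m : p.L ⟶ G) (H : TypedGraph TG) : Prop :=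
  ∃ (D : TypedGraph TG) (k : p.K ⟶ D) (n : p.R ⟶ H) (f : D ⟶ G) (g : D ⟶ H),
    IsPushout p.l k m f ∧ IsPushout p.r k n g

/-- A graph transformation system: a type graph and a set of production rules. -/
structure GTS where
  TG : Graph
  rules : Set (Rule TG)

/-- One transformation step, by an injective match of some rule. -/
def GTS.Step (S : GTS) (G H : TypedGraph S.TG) : Prop :=
  ∃ p ∈ S.rules, ∃ m : p.L ⟶ G, IsInjective m ∧ DPO p m H

/-- A GTS is terminating if there is no infinite derivation `G₀ ⇒ G₁ ⇒ ⋯`. -/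
def GTS.Terminating (S : GTS) : Prop :=
  ¬ ∃ G : ℕ → TypedGraph S.TG, ∀ i, S.Step (G i) (G (i + 1))

/-! ### Constraint Handling Rules -/

open FirstOrder FirstOrder.Language

/-- A complete constraint theory that covers addition and subtraction of integers: the language has
a constant for every integer and two binary function symbols; the theory proves that different
integers are different and it evaluates sums and differences of integers.  Nothing is required
of other symbols. -/
structure ConstraintTheory (𝓛 : FirstOrder.Language.{u, v}) where
  theory : 𝓛.Theory
  complete : theory.IsComplete
  num : ℤ → 𝓛.Constants
  add : 𝓛.Functions 2
  sub : 𝓛.Functions 2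
  num_ne : ∀ a b : ℤ, a ≠ b →
    theory ⊨ᵇ (∼ ((num a).term =' (num b).term) : 𝓛.Sentence)
  add_num : ∀ a b : ℤ,
    theory ⊨ᵇ (add.apply₂ (num a).term (num b).term =' (num (a + b)).term : 𝓛.Sentence)
  sub_num : ∀ a b : ℤ,
    theory ⊨ᵇ (sub.apply₂ (num a).term (num b).term =' (num (a - b)).term : 𝓛.Sentence)

/-- The variables that occur in a term. -/
def termVars {𝓛 : FirstOrder.Language.{u, v}} {Var : Type w} : 𝓛.Term Var → Set Var
  | .var x => {x}
  | .func _ ts => ⋃ i, termVars (ts i)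

/-- The substitution `[x/t]` on terms. -/
noncomputable def termSubst {𝓛 : FirstOrder.Language.{u, v}} {Var : Type w} (x : Var) (t : 𝓛.Term Var)
    (s : 𝓛.Term Var) : 𝓛.Term Var :=
  open Classical in s.subst (Function.update Term.var x t)

/-- Symbols of the user-defined constraints, with their arities. -/
structure Signature where
  Sym : Type
  ar : Sym → ℕ

/-- A user-defined constraint `c(t₁, …, tₙ)`. -/
structure UserConstraint (𝓛 : FirstOrder.Language.{u, v}) (Sig : Signature) (Var : Type w) where
  sym : Sig.Sym
  args : Fin (Sig.ar sym) → 𝓛.Term Var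

namespace UserConstraint

variable {𝓛 : FirstOrder.Language.{u, v}} {Sig : Signature} {Var : Type w}

def vars (c : UserConstraint 𝓛 Sig Var) : Set Var := ⋃ i, termVars (c.args i)

noncomputable def subst (x : Var) (t : 𝓛.Term Var) (c : UserConstraint 𝓛 Sig Var) :
    UserConstraint 𝓛 Sig Var :=
  ⟨c.sym, fun i => termSubst x t (c.args i)⟩

def rename (ρ : Var → Var) (c : UserConstraint 𝓛 Sig Var) : UserConstraint 𝓛 Sig Var :=
  ⟨c.sym, fun i => (c.args i).relabel ρ⟩

end UserConstraint

/-- Built-in constraints: the atomic formulas of the constraint theory, `⊤` and `⊥`. -/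
inductive BuiltIn (𝓛 : FirstOrder.Language.{u, v}) (Var : Type w) where
  | eq (s t : 𝓛.Term Var)
  | rel {n : ℕ} (R : 𝓛.Relations n) (ts : Fin n → 𝓛.Term Var)
  | top
  | bot

namespace BuiltIn

variable {𝓛 : FirstOrder.Language.{u, v}} {Var : Type w}

def vars : BuiltIn 𝓛 Var → Set Var
  | eq s t => termVars s ∪ termVars t
  | rel _ ts => ⋃ i, termVars (ts i)
  | top => ∅
  | bot => ∅

def rename (ρ : Var → Var) : BuiltIn 𝓛 Var → BuiltIn 𝓛 Var
  | eq s t => eq (s.relabel ρ) (t.relabel ρ)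
  | rel R ts => rel R fun i => (ts i).relabel ρ
  | top => top
  | bot => bot

/-- Truth of a built-in constraint in a structure under a valuation of the variables. -/
def Holds {M : Type*} [𝓛.Structure M] (ν : Var → M) : BuiltIn 𝓛 Var → Prop
  | eq s t => s.realize ν = t.realize ν
  | rel R ts => Structure.RelMap R fun i => (ts i).realize ν
  | top => True
  | bot => False

end BuiltIn

/-- The variables of a multiset of user-defined constraints. -/
def goalVars {𝓛 : FirstOrder.Language.{u, v}} {Sig : Signature} {Var : Type w}
    (G : Multiset (UserConstraint 𝓛 Sig Var)) : Set Var := {x | ∃ c ∈ G, x ∈ c.vars}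

/-- The variables of a conjunction of built-in constraints. -/
def storeVars {𝓛 : FirstOrder.Language.{u, v}} {Var : Type w} (B : List (BuiltIn 𝓛 Var)) : Set Var :=
  {x | ∃ c ∈ B, x ∈ c.vars}

/-- A CHR state: goal, built-in store (a conjunction, given as the list of its conjuncts, so that
the empty list is `⊤`), and set of global variables. -/
structure State (𝓛 : FirstOrder.Language.{u, v}) (Sig : Signature) (Var : Type w) where
  goal : Multiset (UserConstraint 𝓛 Sig Var)
  store : List (BuiltIn 𝓛 Var)
  glob : Set Var

section Equivalence

variable {𝓛 : FirstOrder.Language.{u, v}} {Sig : Signature} {Var : Type w}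

/-- `∃ s̄. B` under the valuation `ν`, where `s̄` are the variables outside of `fixed`. -/
def ExHolds {M : Type*} [𝓛.Structure M] (fixed : Set Var) (B : List (BuiltIn 𝓛 Var))
    (ν : Var → M) : Prop :=
  ∃ ν' : Var → M, (∀ x ∈ fixed, ν' x = ν x) ∧ ∀ c ∈ B, c.Holds ν'

/-- `CT ⊨ ∃ s̄. B ↔ ∃ s̄'. B'`, where `s̄`, `s̄'` are the variables of `B`, `B'` outside of `fixed`. -/
def StoreEquiv (CT : ConstraintTheory 𝓛) (fixed : Set Var) (B B' : List (BuiltIn 𝓛 Var)) : Prop :=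
  ∀ (M : Theory.ModelType.{u, v, max u v} CT.theory) (ν : Var → M),
    ExHolds fixed B ν ↔ ExHolds fixed B' ν

/-- The four generating conditions of state equivalence. -/
inductive EquivGen (CT : ConstraintTheory 𝓛) : State 𝓛 Sig Var → State 𝓛 Sig Var → Prop
  | subst (G : Multiset (UserConstraint 𝓛 Sig Var)) (x : Var) (t : 𝓛.Term Var)
      (B : List (BuiltIn 𝓛 Var)) (V : Set Var) :
      EquivGen CT ⟨G, .eq (.var x) t :: B, V⟩
        ⟨G.map (UserConstraint.subst x t), .eq (.var x) t :: B, V⟩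
  | store (G : Multiset (UserConstraint 𝓛 Sig Var)) (B B' : List (BuiltIn 𝓛 Var)) (V : Set Var)
      (h : StoreEquiv CT (V ∪ goalVars G) B B') :
      EquivGen CT ⟨G, B, V⟩ ⟨G, B', V⟩
  | globals (G : Multiset (UserConstraint 𝓛 Sig Var)) (B : List (BuiltIn 𝓛 Var)) (V : Set Var)
      (x : Var) (hG : x ∉ goalVars G) (hB : x ∉ storeVars B) :
      EquivGen CT ⟨G, B, {x} ∪ V⟩ ⟨G, B, V⟩
  | fail (G G' : Multiset (UserConstraint 𝓛 Sig Var)) (V : Set Var) :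
      EquivGen CT ⟨G, [.bot], V⟩ ⟨G', [.bot], V⟩

/-- State equivalence: the smallest equivalence relation satisfying the four conditions. -/
def stateSetoid (CT : ConstraintTheory 𝓛) (Sig : Signature) (Var : Type w) :
    Setoid (State 𝓛 Sig Var) := Relation.EqvGen.setoid (EquivGen CT)

/-- Equivalence classes of CHR states. -/
abbrev StateClass (CT : ConstraintTheory 𝓛) (Sig : Signature) (Var : Type w) :=
  Quotient (stateSetoid CT Sig Var)

/-- The equivalence class of a state. -/
def State.cls (CT : ConstraintTheory 𝓛) (σ : State 𝓛 Sig Var) : StateClass CT Sig Var :=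
  Quotient.mk (stateSetoid CT Sig Var) σ

end Equivalence

/-- A CHR rule `kept \ removed ⇔ guard | bodyU, bodyB`; `kept = ∅` for a simplification rule. -/
structure CHRRule (𝓛 : FirstOrder.Language.{u, v}) (Sig : Signature) (Var : Type w) where
  kept : Multiset (UserConstraint 𝓛 Sig Var)
  removed : Multiset (UserConstraint 𝓛 Sig Var)
  guard : List (BuiltIn 𝓛 Var)
  bodyU : Multiset (UserConstraint 𝓛 Sig Var)
  bodyB : List (BuiltIn 𝓛 Var)

namespace CHRRule

variable {𝓛 : FirstOrder.Language.{u, v}} {Sig : Signature} {Var : Type w}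

/-- The variables of the head and of the guard. -/
def headVars (r : CHRRule 𝓛 Sig Var) : Set Var :=
  goalVars r.kept ∪ goalVars r.removed ∪ storeVars r.guard

/-- All variables of a rule. -/
def vars (r : CHRRule 𝓛 Sig Var) : Set Var :=
  r.headVars ∪ goalVars r.bodyU ∪ storeVars r.bodyB

def rename (ρ : Var → Var) (r : CHRRule 𝓛 Sig Var) : CHRRule 𝓛 Sig Var where
  kept := r.kept.map (UserConstraint.rename ρ)
  removed := r.removed.map (UserConstraint.rename ρ)
  guard := r.guard.map (BuiltIn.rename ρ)
  bodyU := r.bodyU.map (UserConstraint.rename ρ)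
  bodyB := r.bodyB.map (BuiltIn.rename ρ)

/-- `r'` is a copy of `r`: the variables of `r` are renamed apart. -/
def IsCopy (r r' : CHRRule 𝓛 Sig Var) : Prop :=
  ∃ ρ : Var → Var, Set.InjOn ρ r.vars ∧ r' = r.rename ρ

/-- The variables of the rule are fresh for goal `G`, store `B` and global variables `V`.  The store
`B` is where the variables of the head and of the guard are equated with the terms that they match,
so only the remaining variables of the rule are kept out of `B`. -/
def Fresh (r : CHRRule 𝓛 Sig Var) (G : Multiset (UserConstraint 𝓛 Sig Var))
    (B : List (BuiltIn 𝓛 Var)) (V : Set Var) : Prop :=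
  Disjoint r.vars (goalVars G ∪ V) ∧ Disjoint (r.vars \ r.headVars) (storeVars B)

end CHRRule

section Semantics

variable {𝓛 : FirstOrder.Language.{u, v}} {Sig : Signature} {Var : Type w}

/-- The transition relation of a CHR program on equivalence classes of states. -/
def CHRStep (CT : ConstraintTheory 𝓛) (P : Set (CHRRule 𝓛 Sig Var))
    (q q' : StateClass CT Sig Var) : Prop :=
  ∃ r ∈ P, ∃ r' : CHRRule 𝓛 Sig Var, r.IsCopy r' ∧
    ∃ (G : Multiset (UserConstraint 𝓛 Sig Var)) (B : List (BuiltIn 𝓛 Var)) (V : Set Var),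
      r'.Fresh G B V ∧
      q = State.cls CT ⟨r'.kept + r'.removed + G, r'.guard ++ B, V⟩ ∧
      q' = State.cls CT ⟨r'.kept + r'.bodyU + G, r'.guard ++ r'.bodyB ++ B, V⟩

/-- A program terminates on `σ` if no infinite computation starts in (the class of) `σ`. -/
def TerminatesOn (CT : ConstraintTheory 𝓛) (P : Set (CHRRule 𝓛 Sig Var))
    (σ : State 𝓛 Sig Var) : Prop :=
  ¬ ∃ s : ℕ → StateClass CT Sig Var, s 0 = σ.cls CT ∧ ∀ i, CHRStep CT P (s i) (s (i + 1))

end Semantics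

/-! ### The encoding of graph transformation systems in CHR -/

/-- The constraint symbols for graphs typed over `TG`: `v/2` for nodes and `e/3` for edges. -/
def graphSig (TG : Graph) : Signature where
  Sym := TG.V ⊕ TG.E
  ar := Sum.elim (fun _ => 2) (fun _ => 3)

section Encoding

variable {𝓛 : FirstOrder.Language.{u, v}} {Var : Type w} {TG : Graph}

/-- A node constraint `type(x)(id, d)`. -/
def nodeC (G : TypedGraph TG) (x : G.V) (id d : 𝓛.Term Var) :
    UserConstraint 𝓛 (graphSig TG) Var :=
  ⟨Sum.inl (G.type.onV x), (![id, d] : Fin 2 → 𝓛.Term Var)⟩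

/-- An edge constraint `type(e)(id, s, t)`. -/
def edgeC (G : TypedGraph TG) (e : G.E) (id s t : 𝓛.Term Var) :
    UserConstraint 𝓛 (graphSig TG) Var :=
  ⟨Sum.inr (G.type.onE e), (![id, s, t] : Fin 3 → 𝓛.Term Var)⟩

/-- `chr_G(gnd, x)` for a node `x`: the degree is given as a constant. -/
noncomputable def chrGnd (CT : ConstraintTheory 𝓛) (G : TypedGraph TG) (var : G.V ⊕ G.E → Var)
    (x : G.V) : UserConstraint 𝓛 (graphSig TG) Var :=
  nodeC G x (.var (var (.inl x))) (CT.num (G.deg x)).term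

/-- `chr_G(kp, x)` for a node `x`: the degree is given by the degree variable. -/
def chrKp (G : TypedGraph TG) (var : G.V ⊕ G.E → Var) (dvar : G.V → Var) (x : G.V) :
    UserConstraint 𝓛 (graphSig TG) Var :=
  nodeC G x (.var (var (.inl x))) (.var (dvar x))

/-- `chr_G(gnd, e) = chr_G(kp, e)` for an edge `e`. -/
def chrEdge (G : TypedGraph TG) (var : G.V ⊕ G.E → Var) (e : G.E) :
    UserConstraint 𝓛 (graphSig TG) Var :=
  edgeC G e (.var (var (.inr e))) (.var (var (.inl (G.src e)))) (.var (var (.inl (G.tgt e))))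

/-- `chr(gnd, G)`. -/
noncomputable def chrHost (CT : ConstraintTheory 𝓛) (G : TypedGraph TG) (var : G.V ⊕ G.E → Var) :
    Multiset (UserConstraint 𝓛 (graphSig TG) Var) :=
  (Finset.univ : Finset G.V).val.map (chrGnd CT G var) +
    (Finset.univ : Finset G.E).val.map (chrEdge G var)

/-- The different variables in the encoding of a rule: `var` on the items of `L` and on the items of
`R` outside of `K`, `dvar` on the nodes of `L`, and `var(v')`, `dvar(v')` for the nodes `v` of
`K`. -/
inductive RuleVar (p : Rule TG) where
  | ofL (x : p.L.V ⊕ p.L.E)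
  | newNode (x : p.R.V) (hx : x ∉ Set.range (homV p.r))
  | newEdge (e : p.R.E) (he : e ∉ Set.range (homE p.r))
  | dvar (x : p.L.V)
  | node' (x : p.K.V)
  | dvar' (x : p.K.V)

/-- `var` on the items of `R`; an item of `K` has the same variable in `L` and in `R`. -/
noncomputable def RuleVar.ofR (p : Rule TG) : p.R.V ⊕ p.R.E → RuleVar p
  | .inl x => open Classical in
      if h : x ∈ Set.range (homV p.r) then .ofL (.inl (homV p.l h.choose)) else .newNode x h
  | .inr e => open Classical in
      if h : e ∈ Set.range (homE p.r) then .ofL (.inr (homE p.l h.choose)) else .newEdge e h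

/-- The CHR simplification rule that encodes the production rule `p`. The injection `name` chooses the
variables. -/
noncomputable def encodeRule (CT : ConstraintTheory 𝓛) (p : Rule TG) (name : RuleVar p ↪ Var) :
    CHRRule 𝓛 (graphSig TG) Var :=
  let varL : p.L.V ⊕ p.L.E → Var := fun x => name (.ofL x)
  let varR : p.R.V ⊕ p.R.E → Var := fun x => name (RuleVar.ofR p x)
  let dvar : p.L.V → Var := fun x => name (.dvar x)
  open Classical in
  { kept := 0
    removed :=
      (Finset.univ : Finset p.K.V).val.map (fun x => chrKp p.L varL dvar (homV p.l x)) +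
      (Finset.univ : Finset p.K.E).val.map (fun e => chrEdge p.L varL (homE p.l e)) +
      (Finset.univ.filter fun x => x ∉ Set.range (homV p.l)).val.map (chrGnd CT p.L varL) +
      (Finset.univ.filter fun e => e ∉ Set.range (homE p.l)).val.map (chrEdge p.L varL)
    guard := []
    bodyU :=
      (Finset.univ.filter fun x => x ∉ Set.range (homV p.r)).val.map (chrGnd CT p.R varR) +
      (Finset.univ.filter fun e => e ∉ Set.range (homE p.r)).val.map (chrEdge p.R varR) +
      (Finset.univ : Finset p.K.E).val.map (fun e => chrEdge p.R varR (homE p.r e)) +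
      (Finset.univ : Finset p.K.V).val.map (fun x =>
        nodeC p.R (homV p.r x) (.var (name (.node' x))) (.var (name (.dvar' x))))
    bodyB :=
      (Finset.univ : Finset p.K.V).toList.flatMap fun x =>
        [ .eq (.var (varL (.inl (homV p.l x)))) (.var (name (.node' x))),
          .eq (.var (name (.dvar' x)))
            (CT.add.apply₂
              (CT.sub.apply₂ (.var (dvar (homV p.l x))) (CT.num (p.L.deg (homV p.l x))).term)
              (CT.num (p.R.deg (homV p.r x))).term) ] }

/-- The GTS-CHR program of a GTS. -/
def GTS.toCHR (CT : ConstraintTheory 𝓛) (S : GTS) (name : ∀ p : Rule S.TG, RuleVar p ↪ Var) :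
    Set (CHRRule 𝓛 (graphSig S.TG) Var) :=
  {r | ∃ p ∈ S.rules, r = encodeRule CT p (name p)}

/-- Constraints of the form `X = c`. -/
def IsConstEq (b : BuiltIn 𝓛 Var) : Prop :=
  ∃ (X : Var) (c : 𝓛.Constants), b = .eq (.var X) c.term

/-- Constraints of the form `X = Y + c₁ - c₂`. -/
def IsShift (CT : ConstraintTheory 𝓛) (b : BuiltIn 𝓛 Var) : Prop :=
  ∃ (X Y : Var) (c₁ c₂ : 𝓛.Constants),
    b = .eq (.var X) (CT.sub.apply₂ (CT.add.apply₂ (.var Y) c₁.term) c₂.term)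

/-- The graph invariant `𝒢`. -/
def GraphInvariant (CT : ConstraintTheory 𝓛) (σ : State 𝓛 (graphSig TG) Var) : Prop :=
  (∀ b ∈ σ.store, IsConstEq b ∨ IsShift CT b) ∧
  ∃ (G : TypedGraph TG) (var : G.V ⊕ G.E ↪ Var) (B : List (BuiltIn 𝓛 Var)),
    (∀ b ∈ B, IsConstEq b) ∧
    State.cls CT ⟨σ.goal, σ.store ++ B, ∅⟩ = State.cls CT ⟨chrHost CT G var, [], ∅⟩

/-- `𝒢`-termination: the program terminates on all states that satisfy the graph invariant. -/
def GTerminating (CT : ConstraintTheory 𝓛) (P : Set (CHRRule 𝓛 (graphSig TG) Var)) : Prop :=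
  ∀ σ : State 𝓛 (graphSig TG) Var, GraphInvariant CT σ → TerminatesOn CT P σ

end Encoding

end GTSCHR

/-! For the direction from graphs to programs, states are interpreted in a model `M` of the
constraint theory. A class encodes a graph `G` (`ClassEncodes`) if some solution of the store turns
the goal into the encoding of `G`, with pairwise different node identifiers. State equivalence
preserves the instances of a state (`realizes_iff_of_cls_eq`), so any representative may be used.
Suppose that a rule fires. The instance of its head is a sub-multiset of the encoding of `G`, which
gives an injective match (`exists_match`). A deleted node carries its degree in `L` as a constant,
and different integers differ in `M`, so the node has the same degree in `G` as in `L`. This is the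
dangling condition: all its edges are matched, and the pushout complement exists
(`exists_isGluedSquare`). The rest of the goal encodes the context, and suitable values of the fresh
body variables give an instance of the successor state that encodes the transformed graph
(`exists_dpo_of_realizes`). An infinite computation from a state with the graph invariant thus
traces an infinite derivation.

Conversely, an infinite derivation is simulated from the encoding of its first graph with empty
store. For each step, a fresh copy of the rule is taken, and a store in solved form binds its head
variables to the items and degrees of `G`. A solved store can be substituted into the goal and
dropped (`cls_eq_of_solved`), so the state before the step is equivalent to the encoding of `G`. The
store after the step has a solved form as well, and its elimination leaves the encoding of `H`,
where created items are named by fresh variables (`exists_chrStep_of_dpo`).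

Both directions rest on one computation. The edges of a pushout are those of `D` and those of `L`
outside of `K`; hence a preserved node has degree `deg_G - deg_L + deg_R` after the step
(`deg_transform`), which is what the built-in body computes, while nodes of the context outside of
`K` keep their degrees. -/

namespace GTSCHR

open CategoryTheory TypedGraph FirstOrder FirstOrder.Language

/-! ### Pushouts of typed graphs along inclusions -/

section Gluing

variable {K L D G X : Type*}

/-- `G` is the disjoint union of the image of `D` and of the image of the complement of `K` in `L`,
both of which are injective. -/
def IsGluing (l : K → L) (m : L → G) (f : D → G) : Prop :=
  Function.Bijective (Sum.elim f fun x : {x // x ∉ Set.range l} => m x)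

namespace IsGluing

variable {l : K → L} {k : K → D} {m : L → G} {f : D → G}

theorem injective (h : IsGluing l m f) : Function.Injective f := fun a b hab =>
  Sum.inl_injective (h.1 (a₁ := .inl a) (a₂ := .inl b) hab)

theorem injOn (h : IsGluing l m f) {x y : L} (hx : x ∉ Set.range l) (hy : y ∉ Set.range l)
    (hxy : m x = m y) : x = y :=
  congrArg Subtype.val
    (Sum.inr_injective (h.1 (a₁ := .inr ⟨x, hx⟩) (a₂ := .inr ⟨y, hy⟩) hxy))

theorem ne (h : IsGluing l m f) {x : L} (hx : x ∉ Set.range l) (d : D) : f d ≠ m x := fun hxy =>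
  Sum.inl_ne_inr (h.1 (a₁ := .inl d) (a₂ := .inr ⟨x, hx⟩) hxy)

theorem cases (h : IsGluing l m f) (y : G) :
    (∃ d, y = f d) ∨ ∃ x, x ∉ Set.range l ∧ y = m x := by
  obtain ⟨d | x, rfl⟩ := h.2 y
  · exact .inl ⟨d, rfl⟩
  · exact .inr ⟨x, x.2, rfl⟩

/-- The image of `L` is injective if the map `K → D` is. -/
theorem injective_right (h : IsGluing l m f) (comm : ∀ x, m (l x) = f (k x))
    (hk : Function.Injective k) : Function.Injective m := by
  intro x y hxy
  by_cases hx : x ∈ Set.range l <;> by_cases hy : y ∈ Set.range l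
  · obtain ⟨x, rfl⟩ := hx
    obtain ⟨y, rfl⟩ := hy
    rw [comm, comm] at hxy
    rw [hk (h.injective hxy)]
  · obtain ⟨x, rfl⟩ := hx
    rw [comm] at hxy
    exact (h.ne hy _ hxy).elim
  · obtain ⟨y, rfl⟩ := hy
    rw [comm] at hxy
    exact (h.ne hx _ hxy.symm).elim
  · exact h.injOn hx hy hxy

/-- The function on `G` that is given by functions on `L` and `D`. -/
noncomputable def desc (h : IsGluing l m f) (a : L → X) (b : D → X) (y : G) : X :=
  Sum.elim b (fun x : {x // x ∉ Set.range l} => a x) ((Equiv.ofBijective _ h).symm y)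

theorem desc_left (h : IsGluing l m f) (a : L → X) (b : D → X) (d : D) :
    h.desc a b (f d) = b d := by
  have : (Equiv.ofBijective _ h).symm (f d) = .inl d := by
    rw [Equiv.symm_apply_eq]; rfl
  rw [desc, this]; rfl

theorem desc_right_of_notMem (h : IsGluing l m f) (a : L → X) (b : D → X) {x : L}
    (hx : x ∉ Set.range l) : h.desc a b (m x) = a x := by
  have : (Equiv.ofBijective _ h).symm (m x) = .inr ⟨x, hx⟩ := by
    rw [Equiv.symm_apply_eq]; rfl
  rw [desc, this]; rfl

theorem desc_right (h : IsGluing l m f) (comm : ∀ x, m (l x) = f (k x)) {a : L → X} {b : D → X}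
    (hab : ∀ x, a (l x) = b (k x)) (x : L) : h.desc a b (m x) = a x := by
  by_cases hx : x ∈ Set.range l
  · obtain ⟨x, rfl⟩ := hx
    rw [comm, desc_left, hab]
  · exact h.desc_right_of_notMem a b hx

/-- Degrees and encodings are both sums over the items of a graph, so this one identity splits both
of them along a pushout. -/
theorem sum_eq [Fintype D] [Fintype G] [Fintype {x // x ∉ Set.range l}] {A : Type*}
    [AddCommMonoid A] (h : IsGluing l m f) (φ : G → A) :
    ∑ y, φ y = ∑ d, φ (f d) + ∑ x : {x // x ∉ Set.range l}, φ (m x) := by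
  rw [← (Equiv.ofBijective _ h).sum_comp, Fintype.sum_sum_type]
  rfl

end IsGluing

/-- The degenerate gluing with `D = K`. Through `sum_eq` it splits a sum over `L` into the part from
`K` and the rest. -/
theorem isGluing_val (l : K → L) (hl : Function.Injective l) :
    IsGluing l (id : L → L) l := by
  constructor
  · rintro (x | ⟨x, hx⟩) (y | ⟨y, hy⟩) h
    · exact congrArg _ (hl h)
    · exact (hy ⟨x, h⟩).elim
    · exact (hx ⟨y, h.symm⟩).elim
    · exact congrArg _ (Subtype.ext h)
  · intro y
    by_cases hy : y ∈ Set.range l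
    · obtain ⟨x, rfl⟩ := hy
      exact ⟨.inl x, rfl⟩
    · exact ⟨.inr ⟨y, hy⟩, rfl⟩

open Classical in
/-- The map from `L` to the disjoint union of `D` and the complement of `K` in `L`. -/
noncomputable def glue (l : K → L) (k : K → D) (x : L) : D ⊕ {x // x ∉ Set.range l} :=
  if h : x ∈ Set.range l then .inl (k h.choose) else .inr ⟨x, h⟩

theorem glue_apply {l : K → L} (hl : Function.Injective l) (k : K → D) (x : K) :
    glue l k (l x) = .inl (k x) := by
  have h : l x ∈ Set.range l := ⟨x, rfl⟩
  rw [glue, dif_pos h, hl h.choose_spec]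

theorem glue_of_notMem {l : K → L} (k : K → D) {x : L} (hx : x ∉ Set.range l) :
    glue l k x = .inr ⟨x, hx⟩ := dif_neg hx

theorem isGluing_glue (l : K → L) (k : K → D) : IsGluing l (glue l k) Sum.inl := by
  have : (Sum.elim Sum.inl fun x : {x // x ∉ Set.range l} => glue l k x) = id := by
    funext y
    rcases y with d | x
    · rfl
    · exact glue_of_notMem k x.2
  rw [IsGluing, this]
  exact Function.bijective_id

end Gluing

/-! ### From gluings of sets to pushouts of typed graphs -/

namespace TypedGraph

variable {TG : Graph} {G H J K L D : TypedGraph TG}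

theorem homV_src (f : G ⟶ H) (e : G.E) : homV f (G.src e) = H.src (homE f e) :=
  TypedGraph.Hom.toGraphHom f |>.src_comm e

theorem homV_tgt (f : G ⟶ H) (e : G.E) : homV f (G.tgt e) = H.tgt (homE f e) :=
  TypedGraph.Hom.toGraphHom f |>.tgt_comm e

theorem type_homV (f : G ⟶ H) (x : G.V) : H.type.onV (homV f x) = G.type.onV x :=
  TypedGraph.Hom.type_onV f x

theorem type_homE (f : G ⟶ H) (e : G.E) : H.type.onE (homE f e) = G.type.onE e :=
  TypedGraph.Hom.type_onE f e

theorem hom_ext {f g : G ⟶ H} (hV : ∀ x, homV f x = homV g x) (hE : ∀ e, homE f e = homE g e) :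
    f = g :=
  TypedGraph.Hom.ext (funext hV) (funext hE)

/-- Nodes and edges can be treated separately. The induced functions form a morphism because every
edge of `G` comes from an edge of `D` or of `L`, where source and target are already respected. -/
theorem isPushout_of_isGluing {l : K ⟶ L} {k : K ⟶ D} {m : L ⟶ G} {f : D ⟶ G}
    (comm : l ≫ m = k ≫ f) (hV : IsGluing (homV l) (homV m) (homV f))
    (hE : IsGluing (homE l) (homE m) (homE f)) : IsPushout l k m f := by
  have cV (x) : homV m (homV l x) = homV f (homV k x) := congrArg (fun h => homV h x) comm
  have cE (x) : homE m (homE l x) = homE f (homE k x) := congrArg (fun h => homE h x) comm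
  refine IsPushout.of_isColimit' ⟨comm⟩ <| Limits.PushoutCocone.IsColimit.mk _ (fun s =>
    have sV (x) : homV s.inl (homV l x) = homV s.inr (homV k x) :=
      congrArg (fun h => homV h x) s.condition
    have sE (x) : homE s.inl (homE l x) = homE s.inr (homE k x) :=
      congrArg (fun h => homE h x) s.condition
    { onV := hV.desc (homV s.inl) (homV s.inr)
      onE := hE.desc (homE s.inl) (homE s.inr)
      src_comm := fun e => by
        rcases hE.cases e with ⟨d, rfl⟩ | ⟨x, hx, rfl⟩
        · rw [← homV_src, hV.desc_left, hE.desc_left, homV_src]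
        · rw [← homV_src, hV.desc_right cV sV, hE.desc_right cE sE, homV_src]
      tgt_comm := fun e => by
        rcases hE.cases e with ⟨d, rfl⟩ | ⟨x, hx, rfl⟩
        · rw [← homV_tgt, hV.desc_left, hE.desc_left, homV_tgt]
        · rw [← homV_tgt, hV.desc_right cV sV, hE.desc_right cE sE, homV_tgt]
      type_onV := fun y => by
        rcases hV.cases y with ⟨d, rfl⟩ | ⟨x, hx, rfl⟩
        · rw [hV.desc_left, type_homV, type_homV]
        · rw [hV.desc_right cV sV, type_homV, type_homV]
      type_onE := fun y => by
        rcases hE.cases y with ⟨d, rfl⟩ | ⟨x, hx, rfl⟩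
        · rw [hE.desc_left, type_homE, type_homE]
        · rw [hE.desc_right cE sE, type_homE, type_homE] }) ?_ ?_ ?_
  · intro s
    exact hom_ext (hV.desc_right cV fun x => congrArg (fun h => homV h x) s.condition)
      (hE.desc_right cE fun x => congrArg (fun h => homE h x) s.condition)
  · intro s
    exact hom_ext (hV.desc_left _ _) (hE.desc_left _ _)
  · intro s t h₁ h₂
    refine hom_ext (fun y => ?_) (fun y => ?_)
    · rcases hV.cases y with ⟨d, rfl⟩ | ⟨x, hx, rfl⟩
      · exact (congrArg (fun h => homV h d) h₂).trans (hV.desc_left _ _ d).symm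
      · exact (congrArg (fun h => homV h x) h₁).trans (hV.desc_right_of_notMem _ _ hx).symm
    · rcases hE.cases y with ⟨d, rfl⟩ | ⟨x, hx, rfl⟩
      · exact (congrArg (fun h => homE h d) h₂).trans (hE.desc_left _ _ d).symm
      · exact (congrArg (fun h => homE h x) h₁).trans (hE.desc_right_of_notMem _ _ hx).symm

/-- The pushout of an injective morphism exists and is a gluing. -/
theorem exists_isPushout_isGluing (l : K ⟶ L) (k : K ⟶ D) (hl : IsInjective l) :
    ∃ (P : TypedGraph TG) (m : L ⟶ P) (f : D ⟶ P), IsPushout l k m f ∧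
      IsGluing (homV l) (homV m) (homV f) ∧ IsGluing (homE l) (homE m) (homE f) := by
  classical
  let gV := glue (homV l) (homV k)
  let gE := glue (homE l) (homE k)
  let typeV : D.V ⊕ {x // x ∉ Set.range (homV l)} → TG.V :=
    Sum.elim D.type.onV fun x => L.type.onV x
  let typeE : D.E ⊕ {x // x ∉ Set.range (homE l)} → TG.E :=
    Sum.elim D.type.onE fun x => L.type.onE x
  have hgV (x) : gV (homV l x) = .inl (homV k x) := glue_apply hl.1 _ x
  have hgE (x) : gE (homE l x) = .inl (homE k x) := glue_apply hl.2 _ x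
  have htV (x) : typeV (gV x) = L.type.onV x := by
    by_cases hx : x ∈ Set.range (homV l)
    · obtain ⟨x, rfl⟩ := hx
      rw [hgV, type_homV]
      exact type_homV k x
    · rw [show gV x = _ from glue_of_notMem _ hx]
      rfl
  have htE (x) : typeE (gE x) = L.type.onE x := by
    by_cases hx : x ∈ Set.range (homE l)
    · obtain ⟨x, rfl⟩ := hx
      rw [hgE, type_homE]
      exact type_homE k x
    · rw [show gE x = _ from glue_of_notMem _ hx]
      rfl
  let P : TypedGraph TG :=
    { V := D.V ⊕ {x // x ∉ Set.range (homV l)}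
      E := D.E ⊕ {x // x ∉ Set.range (homE l)}
      -- An edge of `L` outside of `K` may end at a node of `K`; `gV` sends that end to its image in
      -- `D`.
      src := Sum.elim (fun e => .inl (D.src e)) fun e => gV (L.src e)
      tgt := Sum.elim (fun e => .inl (D.tgt e)) fun e => gV (L.tgt e)
      type :=
        { onV := typeV
          onE := typeE
          src_comm := by
            rintro (e | e)
            · exact D.type.src_comm e
            · exact (htV _).trans (L.type.src_comm e)
          tgt_comm := by
            rintro (e | e)
            · exact D.type.tgt_comm e
            · exact (htV _).trans (L.type.tgt_comm e) } }
  let m : L ⟶ P :=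
    { onV := gV
      onE := gE
      src_comm := fun e => by
        by_cases he : e ∈ Set.range (homE l)
        · obtain ⟨e, rfl⟩ := he
          rw [← homV_src, hgV, hgE, homV_src]
          rfl
        · rw [show gE e = _ from glue_of_notMem _ he]
          rfl
      tgt_comm := fun e => by
        by_cases he : e ∈ Set.range (homE l)
        · obtain ⟨e, rfl⟩ := he
          rw [← homV_tgt, hgV, hgE, homV_tgt]
          rfl
        · rw [show gE e = _ from glue_of_notMem _ he]
          rfl
      type_onV := htV
      type_onE := htE }
  let f : D ⟶ P :=
    { onV := .inl
      onE := .inl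
      src_comm := fun _ => rfl
      tgt_comm := fun _ => rfl
      type_onV := fun _ => rfl
      type_onE := fun _ => rfl }
  have hV : IsGluing (homV l) (homV m) (homV f) := isGluing_glue _ _
  have hE : IsGluing (homE l) (homE m) (homE f) := isGluing_glue _ _
  exact ⟨P, m, f, isPushout_of_isGluing (hom_ext hgV hgE) hV hE, hV, hE⟩

/-- Pushouts are unique up to isomorphism, and isomorphisms are bijective on nodes and edges, so the
property is transported from the explicit pushout. -/
theorem isGluing_of_isPushout {l : K ⟶ L} {k : K ⟶ D} {m : L ⟶ G} {f : D ⟶ G}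
    (hl : IsInjective l) (h : IsPushout l k m f) :
    IsGluing (homV l) (homV m) (homV f) ∧ IsGluing (homE l) (homE m) (homE f) := by
  obtain ⟨P, m', f', h', hV, hE⟩ := exists_isPushout_isGluing l k hl
  let i := h'.isoIsPushout _ _ h
  have hm : m' ≫ i.hom = m := h'.inl_isoIsPushout_hom _ _ h
  have hf : f' ≫ i.hom = f := h'.inr_isoIsPushout_hom _ _ h
  have iV : Function.Bijective (homV i.hom) :=
    Function.bijective_iff_has_inverse.2 ⟨homV i.inv,
      fun x => congrArg (fun h => homV h x) i.hom_inv_id,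
      fun x => congrArg (fun h => homV h x) i.inv_hom_id⟩
  have iE : Function.Bijective (homE i.hom) :=
    Function.bijective_iff_has_inverse.2 ⟨homE i.inv,
      fun x => congrArg (fun h => homE h x) i.hom_inv_id,
      fun x => congrArg (fun h => homE h x) i.inv_hom_id⟩
  constructor
  · convert iV.comp hV using 1
    rw [← hm, ← hf, Sum.comp_elim]
    rfl
  · convert iE.comp hE using 1
    rw [← hm, ← hf, Sum.comp_elim]
    rfl

end TypedGraph

/-! ### Degrees in pushouts and pushout complements -/

open Classical in
/-- The number of ends of the edge `e` at the node `x`. -/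
noncomputable def Graph.incidence (G : Graph) (x : G.V) (e : G.E) : ℕ :=
  (if G.src e = x then 1 else 0) + (if G.tgt e = x then 1 else 0)

/-- As a sum over edges, in which a loop contributes 2, the degree becomes accessible to
`IsGluing.sum_eq`. -/
theorem Graph.deg_eq_sum (G : Graph) (x : G.V) : G.deg x = ∑ e, G.incidence x e := by
  classical
  simp only [Graph.deg, Graph.incidence, Finset.sum_add_distrib, Nat.card_eq_fintype_card,
    Fintype.card_subtype, Finset.card_filter]

namespace TypedGraph

variable {TG : Graph} {G H K L D : TypedGraph TG}

theorem incidence_hom {f : G ⟶ H} (hf : Function.Injective (homV f)) (x : G.V) (e : G.E) :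
    H.incidence (homV f x) (homE f e) = G.incidence x e := by
  classical
  have hs : (H.src (homE f e) = homV f x) = (G.src e = x) := by rw [← homV_src, hf.eq_iff]
  have ht : (H.tgt (homE f e) = homV f x) = (G.tgt e = x) := by rw [← homV_tgt, hf.eq_iff]
  exact congrArg₂ (· + ·) (if_congr (iff_of_eq hs) rfl rfl) (if_congr (iff_of_eq ht) rfl rfl)

theorem incidence_eq_zero {x : G.V} {e : G.E} (hs : G.src e ≠ x) (ht : G.tgt e ≠ x) :
    G.incidence x e = 0 := by
  simp [Graph.incidence, hs, ht]

/-- A commutative square of injective morphisms that glues `L` and `D` along `K`. -/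
structure IsGluedSquare (l : K ⟶ L) (k : K ⟶ D) (m : L ⟶ G) (f : D ⟶ G) : Prop where
  left_inj : IsInjective l
  top_inj : IsInjective k
  comm : l ≫ m = k ≫ f
  gluingV : IsGluing (homV l) (homV m) (homV f)
  gluingE : IsGluing (homE l) (homE m) (homE f)

namespace IsGluedSquare

variable {l : K ⟶ L} {k : K ⟶ D} {m : L ⟶ G} {f : D ⟶ G}

theorem isPushout (h : IsGluedSquare l k m f) : IsPushout l k m f :=
  isPushout_of_isGluing h.comm h.gluingV h.gluingE

theorem commV (h : IsGluedSquare l k m f) (x : K.V) :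
    homV m (homV l x) = homV f (homV k x) := congrArg (fun h => homV h x) h.comm

theorem commE (h : IsGluedSquare l k m f) (x : K.E) :
    homE m (homE l x) = homE f (homE k x) := congrArg (fun h => homE h x) h.comm

theorem injV (h : IsGluedSquare l k m f) : Function.Injective (homV m) :=
  h.gluingV.injective_right h.commV h.top_inj.1

theorem of_isPushout_of_top (hl : IsInjective l) (hk : IsInjective k) (h : IsPushout l k m f) :
    IsGluedSquare l k m f :=
  ⟨hl, hk, h.w, (isGluing_of_isPushout hl h).1, (isGluing_of_isPushout hl h).2⟩

/-- Used for the left square of a transformation, where only the match is known to be injective: `k`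
is injective because `m ∘ l = f ∘ k` is. -/
theorem of_isPushout_of_right (hl : IsInjective l) (hm : IsInjective m) (h : IsPushout l k m f) :
    IsGluedSquare l k m f := by
  refine of_isPushout_of_top hl ⟨fun x y hxy => hl.1 (hm.1 ?_), fun x y hxy => hl.2 (hm.2 ?_)⟩ h
  · have c (x) : homV m (homV l x) = homV f (homV k x) := congrArg (fun h => homV h x) h.w
    rw [c, c, hxy]
  · have c (x) : homE m (homE l x) = homE f (homE k x) := congrArg (fun h => homE h x) h.w
    rw [c, c, hxy]

/-- Edges of `L` outside of `K` contribute the same amount to the degree in `G` (beyond `D`) and to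
the degree in `L` (beyond `K`). The additive form avoids truncated subtraction. -/
theorem deg_right_add (h : IsGluedSquare l k m f) (x : K.V) :
    G.deg (homV m (homV l x)) + K.deg x = D.deg (homV k x) + L.deg (homV l x) := by
  classical
  rw [Graph.deg_eq_sum G.toGraph, h.gluingE.sum_eq, Graph.deg_eq_sum L.toGraph,
    (isGluing_val (homE l) h.left_inj.2).sum_eq, Graph.deg_eq_sum K.toGraph,
    Graph.deg_eq_sum D.toGraph]
  simp only [h.commV, id_eq, incidence_hom h.gluingV.injective,
    incidence_hom h.left_inj.1]
  simp only [← h.commV, incidence_hom h.injV]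
  omega

/-- The image of such a node is outside of `D`, so no edge of `D` ends there; likewise no edge of
`K` ends at the node in `L`. Only edges of `L` outside of `K` remain in both counts. -/
theorem deg_right_of_notMem (h : IsGluedSquare l k m f) {x : L.V}
    (hx : x ∉ Set.range (homV l)) : G.deg (homV m x) = L.deg x := by
  classical
  rw [Graph.deg_eq_sum, h.gluingE.sum_eq, Graph.deg_eq_sum,
    (isGluing_val (homE l) h.left_inj.2).sum_eq]
  congr 1
  · rw [Finset.sum_eq_zero, Finset.sum_eq_zero]
    · intro e _
      refine incidence_eq_zero ?_ ?_
      · rw [← homV_src]; exact fun he => hx ⟨_, he⟩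
      · rw [← homV_tgt]; exact fun he => hx ⟨_, he⟩
    · intro e _
      refine incidence_eq_zero ?_ ?_
      · rw [← homV_src]; exact h.gluingV.ne hx _
      · rw [← homV_tgt]; exact h.gluingV.ne hx _
  · exact Finset.sum_congr rfl fun e _ => incidence_hom h.injV _ _

theorem ne_of_notMem_top (h : IsGluedSquare l k m f) {d : D.V} (hd : d ∉ Set.range (homV k))
    (x : L.V) : homV m x ≠ homV f d := by
  intro hx
  by_cases hl : x ∈ Set.range (homV l)
  · obtain ⟨x, rfl⟩ := hl
    rw [h.commV] at hx
    exact hd ⟨x, h.gluingV.injective hx⟩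
  · exact h.gluingV.ne hl _ hx.symm

theorem deg_bottom_of_notMem (h : IsGluedSquare l k m f) {d : D.V}
    (hd : d ∉ Set.range (homV k)) : G.deg (homV f d) = D.deg d := by
  classical
  rw [Graph.deg_eq_sum, h.gluingE.sum_eq, Graph.deg_eq_sum, Finset.sum_eq_zero (s := Finset.univ
    (α := {x // x ∉ Set.range (homE l)})), add_zero]
  · exact Finset.sum_congr rfl fun e _ => incidence_hom h.gluingV.injective _ _
  · intro e _
    refine incidence_eq_zero ?_ ?_
    · rw [← homV_src]; exact h.ne_of_notMem_top hd _
    · rw [← homV_tgt]; exact h.ne_of_notMem_top hd _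

end IsGluedSquare

/-- An injective match that preserves the degree of a node covers all edges at this node. -/
theorem exists_of_deg_eq {m : L ⟶ G} (hm : IsInjective m) {x : L.V}
    (hx : G.deg (homV m x) = L.deg x) (e : G.E) :
    (G.src e = homV m x → ∃ e', homE m e' = e ∧ L.src e' = x) ∧
    (G.tgt e = homV m x → ∃ e', homE m e' = e ∧ L.tgt e' = x) := by
  let φ : {e // L.src e = x} → {e // G.src e = homV m x} :=
    fun e => ⟨homE m e, by rw [← homV_src, e.2]⟩
  let ψ : {e // L.tgt e = x} → {e // G.tgt e = homV m x} :=
    fun e => ⟨homE m e, by rw [← homV_tgt, e.2]⟩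
  have hφ : Function.Injective φ := fun a b hab => Subtype.ext (hm.2 (congrArg Subtype.val hab))
  have hψ : Function.Injective ψ := fun a b hab => Subtype.ext (hm.2 (congrArg Subtype.val hab))
  have h₁ := Nat.card_le_card_of_injective φ hφ
  have h₂ := Nat.card_le_card_of_injective ψ hψ
  unfold Graph.deg at hx
  -- Outgoing and incoming edges each satisfy an inequality of cardinalities; equality of the sums
  -- forces equality in both.
  have bφ : Function.Bijective φ :=
    (Nat.bijective_iff_injective_and_card φ).2 ⟨hφ, by omega⟩
  have bψ : Function.Bijective ψ :=
    (Nat.bijective_iff_injective_and_card ψ).2 ⟨hψ, by omega⟩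
  constructor
  · intro he
    obtain ⟨e', h'⟩ := bφ.2 ⟨e, he⟩
    exact ⟨e', congrArg Subtype.val h', e'.2⟩
  · intro he
    obtain ⟨e', h'⟩ := bψ.2 ⟨e, he⟩
    exact ⟨e', congrArg Subtype.val h', e'.2⟩

theorem isGluing_subtype {K L G : Type*} {l : K → L} {m : L → G} (hm : Function.Injective m) :
    IsGluing l m (Subtype.val : {y : G // ∀ x, x ∉ Set.range l → m x ≠ y} → G) := by
  constructor
  · rintro (⟨a, ha⟩ | ⟨a, ha⟩) (⟨b, hb⟩ | ⟨b, hb⟩) hab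
    · exact congrArg _ (Subtype.ext hab)
    · exact (ha b hb hab.symm).elim
    · exact (hb a ha hab).elim
    · exact congrArg _ (Subtype.ext (hm hab))
  · intro y
    by_cases hy : ∀ x, x ∉ Set.range l → m x ≠ y
    · exact ⟨.inl ⟨y, hy⟩, rfl⟩
    · push Not at hy
      obtain ⟨x, hx, rfl⟩ := hy
      exact ⟨.inr ⟨x, hx⟩, rfl⟩

/-- The pushout complement exists if the deleted nodes have the same degree in `L` and `G`. -/
theorem exists_isGluedSquare {l : K ⟶ L} (hl : IsInjective l) {m : L ⟶ G} (hm : IsInjective m)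
    (hdeg : ∀ x, x ∉ Set.range (homV l) → G.deg (homV m x) = L.deg x) :
    ∃ (D : TypedGraph TG) (k : K ⟶ D) (f : D ⟶ G), IsGluedSquare l k m f := by
  classical
  let D : TypedGraph TG :=
    { V := {y : G.V // ∀ x, x ∉ Set.range (homV l) → homV m x ≠ y}
      E := {e : G.E // ∀ x, x ∉ Set.range (homE l) → homE m x ≠ e}
      -- If a kept edge started at a deleted node `x`, it would be the image of an edge `e'` of `L`
      -- at `x`. As `x` is not in `K`, neither is `e'`, so the edge would have been deleted.
      src := fun e => ⟨G.src e, fun x hx hxe => by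
        obtain ⟨e', he', h⟩ := (exists_of_deg_eq hm (hdeg x hx) e).1 hxe.symm
        refine e.2 e' ?_ he'
        rintro ⟨e'', rfl⟩
        exact hx ⟨_, (homV_src l e'').trans h⟩⟩
      tgt := fun e => ⟨G.tgt e, fun x hx hxe => by
        obtain ⟨e', he', h⟩ := (exists_of_deg_eq hm (hdeg x hx) e).2 hxe.symm
        refine e.2 e' ?_ he'
        rintro ⟨e'', rfl⟩
        exact hx ⟨_, (homV_tgt l e'').trans h⟩⟩
      type :=
        { onV := fun y => G.type.onV y
          onE := fun e => G.type.onE e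
          src_comm := fun e => G.type.src_comm e
          tgt_comm := fun e => G.type.tgt_comm e } }
  let k : K ⟶ D :=
    { onV := fun x => ⟨homV m (homV l x), fun y hy h => hy ⟨x, (hm.1 h).symm⟩⟩
      onE := fun x => ⟨homE m (homE l x), fun y hy h => hy ⟨x, (hm.2 h).symm⟩⟩
      src_comm := fun e => Subtype.ext <| by
        change homV m (homV l _) = G.src (homE m (homE l e))
        rw [homV_src, homV_src]
      tgt_comm := fun e => Subtype.ext <| by
        change homV m (homV l _) = G.tgt (homE m (homE l e))
        rw [homV_tgt, homV_tgt]
      type_onV := fun x => by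
        change G.type.onV (homV m (homV l x)) = _
        rw [type_homV, type_homV]
      type_onE := fun x => by
        change G.type.onE (homE m (homE l x)) = _
        rw [type_homE, type_homE] }
  let f : D ⟶ G :=
    { onV := Subtype.val
      onE := Subtype.val
      src_comm := fun _ => rfl
      tgt_comm := fun _ => rfl
      type_onV := fun _ => rfl
      type_onE := fun _ => rfl }
  refine ⟨D, k, f, hl, ⟨fun x y h => hl.1 (hm.1 (congrArg Subtype.val h)),
    fun x y h => hl.2 (hm.2 (congrArg Subtype.val h))⟩, rfl, ?_, ?_⟩
  · exact isGluing_subtype hm.1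
  · exact isGluing_subtype hm.2

theorem exists_isGluedSquare_of_span (l : K ⟶ L) (k : K ⟶ D) (hl : IsInjective l)
    (hk : IsInjective k) :
    ∃ (G : TypedGraph TG) (m : L ⟶ G) (f : D ⟶ G), IsGluedSquare l k m f := by
  obtain ⟨G, m, f, h, hV, hE⟩ := exists_isPushout_isGluing l k hl
  exact ⟨G, m, f, hl, hk, h.w, hV, hE⟩

end TypedGraph

/-! ### Encodings of graphs with arguments of an arbitrary type -/

/-- A constraint symbol with arguments from `A`. -/
abbrev Atom (Sig : Signature) (A : Type*) := Σ s : Sig.Sym, (Fin (Sig.ar s) → A)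

section Atoms

variable {TG : Graph} {A : Type*}

/-- The argument type stays open because the same identities are needed for elements of a model
(instances of states), for terms (equality of goals) and for sets of variables (freshness). -/
def nodeAtom (t : TG.V) (id d : A) : Atom (graphSig TG) A := ⟨Sum.inl t, (![id, d] : Fin 2 → A)⟩

def edgeAtom (t : TG.E) (id s t' : A) : Atom (graphSig TG) A :=
  ⟨Sum.inr t, (![id, s, t'] : Fin 3 → A)⟩

theorem nodeAtom_inj {t t' : TG.V} {i i' d d' : A} :
    nodeAtom t i d = nodeAtom t' i' d' ↔ t = t' ∧ i = i' ∧ d = d' := by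
  constructor
  · intro h
    obtain ⟨h₁, h₂⟩ := Sigma.mk.inj_iff.1 h
    obtain rfl := Sum.inl_injective h₁
    have h₃ : (![i, d] : Fin 2 → A) = ![i', d'] := eq_of_heq h₂
    exact ⟨rfl, congrFun h₃ 0, congrFun h₃ 1⟩
  · rintro ⟨rfl, rfl, rfl⟩; rfl

theorem edgeAtom_inj {t t' : TG.E} {i i' a a' b b' : A} :
    edgeAtom t i a b = edgeAtom t' i' a' b' ↔ t = t' ∧ i = i' ∧ a = a' ∧ b = b' := by
  constructor
  · intro h
    obtain ⟨h₁, h₂⟩ := Sigma.mk.inj_iff.1 h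
    obtain rfl := Sum.inr_injective h₁
    have h₃ : (![i, a, b] : Fin 3 → A) = ![i', a', b'] := eq_of_heq h₂
    exact ⟨rfl, congrFun h₃ 0, congrFun h₃ 1, congrFun h₃ 2⟩
  · rintro ⟨rfl, rfl, rfl, rfl⟩; rfl

theorem nodeAtom_ne_edgeAtom (t : TG.V) (t' : TG.E) (i d i' a b : A) :
    nodeAtom t i d ≠ edgeAtom t' i' a b := fun h =>
  Sum.inl_ne_inr (congrArg Sigma.fst h)

open scoped Classical

/-- The encoding of a host graph. -/
noncomputable def hostAtoms (num : ℤ → A) (G : TypedGraph TG) (idV : G.V → A) (idE : G.E → A) :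
    Multiset (Atom (graphSig TG) A) :=
  ∑ x, {nodeAtom (G.type.onV x) (idV x) (num (G.deg x))} +
    ∑ e, {edgeAtom (G.type.onE e) (idE e) (idV (G.src e)) (idV (G.tgt e))}

/-- The encoding of the left-hand side of a rule. -/
noncomputable def headAtoms (num : ℤ → A) (p : Rule TG) (a : RuleVar p → A) :
    Multiset (Atom (graphSig TG) A) :=
  ∑ x, {nodeAtom (p.L.type.onV (homV p.l x)) (a (.ofL (.inl (homV p.l x))))
    (a (.dvar (homV p.l x)))} +
  ∑ e, {edgeAtom (p.L.type.onE (homE p.l e)) (a (.ofL (.inr (homE p.l e))))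
    (a (.ofL (.inl (p.L.src (homE p.l e))))) (a (.ofL (.inl (p.L.tgt (homE p.l e)))))} +
  ∑ x : {x // x ∉ Set.range (homV p.l)},
    {nodeAtom (p.L.type.onV x) (a (.ofL (.inl x))) (num (p.L.deg x))} +
  ∑ e : {e // e ∉ Set.range (homE p.l)},
    {edgeAtom (p.L.type.onE e) (a (.ofL (.inr e)))
      (a (.ofL (.inl (p.L.src e)))) (a (.ofL (.inl (p.L.tgt e))))}

/-- The encoding of the right-hand side of a rule. -/
noncomputable def bodyAtoms (num : ℤ → A) (p : Rule TG) (a : RuleVar p → A) :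
    Multiset (Atom (graphSig TG) A) :=
  ∑ x : {x // x ∉ Set.range (homV p.r)},
    {nodeAtom (p.R.type.onV x) (a (.ofR p (.inl x))) (num (p.R.deg x))} +
  ∑ e : {e // e ∉ Set.range (homE p.r)},
    {edgeAtom (p.R.type.onE e) (a (.ofR p (.inr e)))
      (a (.ofR p (.inl (p.R.src e)))) (a (.ofR p (.inl (p.R.tgt e))))} +
  ∑ e, {edgeAtom (p.R.type.onE (homE p.r e)) (a (.ofR p (.inr (homE p.r e))))
    (a (.ofR p (.inl (p.R.src (homE p.r e))))) (a (.ofR p (.inl (p.R.tgt (homE p.r e)))))} +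
  ∑ x, {nodeAtom (p.R.type.onV (homV p.r x)) (a (.node' x)) (a (.dvar' x))}

/-- The encoding of the items of `D` outside of the image of `K`. -/
noncomputable def contextAtoms (num : ℤ → A) {K D : TypedGraph TG} (k : K ⟶ D) (idV : D.V → A)
    (idE : D.E → A) : Multiset (Atom (graphSig TG) A) :=
  ∑ x : {x // x ∉ Set.range (homV k)},
    {nodeAtom (D.type.onV x) (idV x) (num (D.deg x))} +
  ∑ e : {e // e ∉ Set.range (homE k)},
    {edgeAtom (D.type.onE e) (idE e) (idV (D.src e)) (idV (D.tgt e))}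

namespace TypedGraph.IsGluedSquare

variable {G H K L D : TypedGraph TG} {l : K ⟶ L} {k : K ⟶ D} {m : L ⟶ G} {f : D ⟶ G}

/-- Only the nodes of `K` get a degree that has to be read off in `G`: nodes of `L` outside of `K`
have their degree in `L`, and nodes of `D` outside of `K` their degree in `D`. -/
theorem hostAtoms_eq (h : IsGluedSquare l k m f) (num : ℤ → A) (idV : G.V → A) (idE : G.E → A) :
    hostAtoms num G idV idE =
      ∑ x : K.V, {nodeAtom (L.type.onV (homV l x)) (idV (homV m (homV l x)))
        (num (G.deg (homV m (homV l x))))} +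
      ∑ e : K.E, {edgeAtom (L.type.onE (homE l e)) (idE (homE m (homE l e)))
        (idV (homV m (L.src (homE l e)))) (idV (homV m (L.tgt (homE l e))))} +
      ∑ x : {x // x ∉ Set.range (homV l)}, {nodeAtom (L.type.onV x) (idV (homV m x))
        (num (L.deg x))} +
      ∑ e : {e // e ∉ Set.range (homE l)}, {edgeAtom (L.type.onE e) (idE (homE m e))
        (idV (homV m (L.src e))) (idV (homV m (L.tgt e)))} +
      contextAtoms num k (fun d => idV (homV f d)) (fun d => idE (homE f d)) := by
  have eV : ∑ x : {x // x ∉ Set.range (homV k)},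
      ({nodeAtom (G.type.onV (homV f x)) (idV (homV f x)) (num (G.deg (homV f x)))} :
        Multiset (Atom (graphSig TG) A)) =
      ∑ x : {x // x ∉ Set.range (homV k)},
        {nodeAtom (D.type.onV x) (idV (homV f x)) (num (D.deg x))} :=
    Finset.sum_congr rfl fun x _ => by rw [type_homV, h.deg_bottom_of_notMem x.2]
  have eL : ∑ x : {x // x ∉ Set.range (homV l)},
      ({nodeAtom (G.type.onV (homV m x)) (idV (homV m x)) (num (G.deg (homV m x)))} :
        Multiset (Atom (graphSig TG) A)) =
      ∑ x : {x // x ∉ Set.range (homV l)},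
        {nodeAtom (L.type.onV x) (idV (homV m x)) (num (L.deg x))} :=
    Finset.sum_congr rfl fun x _ => by rw [type_homV, h.deg_right_of_notMem x.2]
  rw [hostAtoms, h.gluingV.sum_eq, h.gluingE.sum_eq, eL,
    (isGluing_val (homV k) h.top_inj.1).sum_eq, (isGluing_val (homE k) h.top_inj.2).sum_eq]
  simp only [id_eq]
  rw [eV]
  simp only [← h.commV, ← h.commE, ← homV_src, ← homV_tgt, type_homV, type_homE, contextAtoms]
  abel

end TypedGraph.IsGluedSquare

theorem RuleVar.ofR_inl (p : Rule TG) (x : p.K.V) :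
    RuleVar.ofR p (.inl (homV p.r x)) = .ofL (.inl (homV p.l x)) := by
  have h : homV p.r x ∈ Set.range (homV p.r) := ⟨x, rfl⟩
  rw [RuleVar.ofR, dif_pos h, p.r_inj.1 h.choose_spec]

theorem RuleVar.ofR_inr (p : Rule TG) (x : p.K.E) :
    RuleVar.ofR p (.inr (homE p.r x)) = .ofL (.inr (homE p.l x)) := by
  have h : homE p.r x ∈ Set.range (homE p.r) := ⟨x, rfl⟩
  rw [RuleVar.ofR, dif_pos h, p.r_inj.2 h.choose_spec]

theorem RuleVar.ofR_inl_of_notMem (p : Rule TG) {x : p.R.V} (hx : x ∉ Set.range (homV p.r)) :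
    RuleVar.ofR p (.inl x) = .newNode x hx := dif_neg hx

theorem RuleVar.ofR_inr_of_notMem (p : Rule TG) {x : p.R.E} (hx : x ∉ Set.range (homE p.r)) :
    RuleVar.ofR p (.inr x) = .newEdge x hx := dif_neg hx

variable {p : Rule TG} {G H D : TypedGraph TG} {m : p.L ⟶ G} {k : p.K ⟶ D} {f : D ⟶ G}
  {n : p.R ⟶ H} {g : D ⟶ H}

/-- The second summand depends only on `D` and the names of its items. It is the part of the goal
that a step leaves alone, and it reappears in `hostAtoms_eq_bodyAtoms_add`. -/
theorem hostAtoms_eq_headAtoms_add (h : IsGluedSquare p.l k m f) {num : ℤ → A}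
    {a : RuleVar p → A} {idV : G.V → A} {idE : G.E → A}
    (hV : ∀ x, a (.ofL (.inl x)) = idV (homV m x)) (hE : ∀ e, a (.ofL (.inr e)) = idE (homE m e))
    (hd : ∀ x, a (.dvar (homV p.l x)) = num (G.deg (homV m (homV p.l x)))) :
    hostAtoms num G idV idE = headAtoms num p a +
      contextAtoms num k (fun d => idV (homV f d)) (fun d => idE (homE f d)) := by
  rw [h.hostAtoms_eq, headAtoms]
  simp only [hV, hE, hd]

theorem hostAtoms_eq_bodyAtoms_add (h : IsGluedSquare p.r k n g) {num : ℤ → A}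
    {a : RuleVar p → A} {idV : H.V → A} {idE : H.E → A}
    (hV : ∀ x, a (.ofR p (.inl x)) = idV (homV n x))
    (hE : ∀ e, a (.ofR p (.inr e)) = idE (homE n e))
    (hi : ∀ x, a (.node' x) = idV (homV n (homV p.r x)))
    (hd : ∀ x, a (.dvar' x) = num (H.deg (homV n (homV p.r x)))) :
    hostAtoms num H idV idE = bodyAtoms num p a +
      contextAtoms num k (fun d => idV (homV g d)) (fun d => idE (homE g d)) := by
  rw [h.hostAtoms_eq, bodyAtoms]
  simp only [hV, hE, hi, hd]
  abel

/-- The degrees of the preserved nodes before and after a transformation. -/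
theorem deg_transform (h : IsGluedSquare p.l k m f) (h' : IsGluedSquare p.r k n g) (x : p.K.V) :
    (H.deg (homV n (homV p.r x)) : ℤ) =
      G.deg (homV m (homV p.l x)) - p.L.deg (homV p.l x) + p.R.deg (homV p.r x) := by
  have h₁ := h.deg_right_add x
  have h₂ := h'.deg_right_add x
  omega

end Atoms

/-! ### Matches from inclusions of multisets -/

section Matching

/-- For each value, the fibre of `ψ` is at most as large as the fibre of `φ`, so the map can be
chosen injectively fibre by fibre. Distinct elements with equal values are thereby kept apart by
their multiplicity. -/
theorem exists_injective_of_map_le {B C X : Type*} {φ : C → X} {ψ : B → X}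
    {s : Multiset B} {t : Multiset C} (hs : s.Nodup) (hs' : ∀ b, b ∈ s) (ht : t.Nodup)
    (h : s.map ψ ≤ t.map φ) :
    ∃ i : B → C, Function.Injective i ∧ ∀ b, φ (i b) = ψ b := by
  classical
  have key (c : X) : Nonempty ({b // b ∈ s.filter fun b => c = ψ b} ↪
      {a // a ∈ t.filter fun a => c = φ a}) := by
    have hc := Multiset.count_le_of_le c h
    rw [Multiset.count_map, Multiset.count_map] at hc
    let s' : Finset B := ⟨_, hs.filter fun b => c = ψ b⟩
    let t' : Finset C := ⟨_, ht.filter fun b => c = φ b⟩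
    have : s'.card ≤ t'.card := hc
    exact Function.Embedding.nonempty_of_card_le
      (α := {b // b ∈ s'}) (β := {b // b ∈ t'}) (by simpa using this)
  let e := fun c => (key c).some
  let i (b : B) : {a // a ∈ t.filter fun a => ψ b = φ a} :=
    e (ψ b) ⟨b, Multiset.mem_filter.2 ⟨hs' b, rfl⟩⟩
  have hi (b : B) : φ (i b) = ψ b := ((Multiset.mem_filter.1 (i b).2).2).symm
  refine ⟨fun b => i b, fun b b' hbb => ?_, hi⟩
  have hψ : ψ b = ψ b' := by rw [← hi b, ← hi b']; exact congrArg φ hbb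
  -- The fibres over `ψ b` and `ψ b'` are different types although the values are equal; the values
  -- are generalized so that one can be replaced by the other.
  have gen : ∀ c c' (_ : c = c') (h₁ : c = ψ b) (h₂ : c' = ψ b'),
      (e c ⟨b, Multiset.mem_filter.2 ⟨hs' b, h₁⟩⟩ : C) =
        e c' ⟨b', Multiset.mem_filter.2 ⟨hs' b', h₂⟩⟩ → b = b' := by
    rintro c _ rfl h₁ h₂ h
    exact congrArg Subtype.val ((e c).injective (Subtype.ext h))
  exact gen _ _ hψ rfl rfl hbb

variable {TG : Graph} {A : Type*} {p : Rule TG}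

theorem sum_singleton {B X : Type*} (s : Finset B) (φ : B → X) :
    ∑ b ∈ s, ({φ b} : Multiset X) = s.val.map φ := by
  rw [Finset.sum, ← Multiset.sum_map_singleton (s.val.map φ), Multiset.map_map]
  rfl

open scoped Classical in
/-- The encoding of the left-hand side of a rule, sorted by nodes and edges. -/
theorem headAtoms_eq (num : ℤ → A) (a : RuleVar p → A) :
    headAtoms num p a =
      ∑ x, {nodeAtom (p.L.type.onV x) (a (.ofL (.inl x)))
        (if x ∈ Set.range (homV p.l) then a (.dvar x) else num (p.L.deg x))} +
      ∑ e, {edgeAtom (p.L.type.onE e) (a (.ofL (.inr e)))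
        (a (.ofL (.inl (p.L.src e)))) (a (.ofL (.inl (p.L.tgt e))))} := by
  rw [(isGluing_val (homV p.l) p.l_inj.1).sum_eq, (isGluing_val (homE p.l) p.l_inj.2).sum_eq,
    headAtoms]
  have e₁ : ∀ x : p.K.V, (if homV p.l x ∈ Set.range (homV p.l) then a (.dvar (homV p.l x))
      else num (p.L.deg (homV p.l x))) = a (.dvar (homV p.l x)) := fun x => if_pos ⟨x, rfl⟩
  have e₂ : ∀ x : {x // x ∉ Set.range (homV p.l)}, (if (x : p.L.V) ∈ Set.range (homV p.l)
      then a (.dvar x) else num (p.L.deg (x : p.L.V))) = num (p.L.deg (x : p.L.V)) :=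
    fun x => if_neg x.2
  simp only [id_eq, e₁, e₂]
  abel

/-- If the encoding of a graph contains the left-hand side of a rule, then there is an injective
match, and the deleted nodes have the right degrees. -/
theorem exists_match {num : ℤ → A} (hnum : Function.Injective num) {a : RuleVar p → A}
    {G : TypedGraph TG} {idV : G.V → A} (hid : Function.Injective idV) {idE : G.E → A}
    {T : Multiset (Atom (graphSig TG) A)}
    (h : hostAtoms num G idV idE = headAtoms num p a + T) :
    ∃ m : p.L ⟶ G, IsInjective m ∧
      (∀ x, x ∉ Set.range (homV p.l) → G.deg (homV m x) = p.L.deg x) ∧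
      (∀ x, a (.ofL (.inl x)) = idV (homV m x)) ∧ (∀ e, a (.ofL (.inr e)) = idE (homE m e)) ∧
      (∀ x, a (.dvar (homV p.l x)) = num (G.deg (homV m (homV p.l x)))) := by
  classical
  let φ : G.V ⊕ G.E → Atom (graphSig TG) A :=
    Sum.elim (fun x => nodeAtom (G.type.onV x) (idV x) (num (G.deg x)))
      fun e => edgeAtom (G.type.onE e) (idE e) (idV (G.src e)) (idV (G.tgt e))
  let ψ : p.L.V ⊕ p.L.E → Atom (graphSig TG) A :=
    Sum.elim (fun x => nodeAtom (p.L.type.onV x) (a (.ofL (.inl x)))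
        (if x ∈ Set.range (homV p.l) then a (.dvar x) else num (p.L.deg x)))
      fun e => edgeAtom (p.L.type.onE e) (a (.ofL (.inr e)))
        (a (.ofL (.inl (p.L.src e)))) (a (.ofL (.inl (p.L.tgt e))))
  have hφ : hostAtoms num G idV idE = Finset.univ.val.map φ := by
    rw [← sum_singleton, Fintype.sum_sum_type]
    rfl
  have hψ : headAtoms num p a = Finset.univ.val.map ψ := by
    rw [← sum_singleton, Fintype.sum_sum_type, headAtoms_eq]
    rfl
  obtain ⟨i, hi, hiφ⟩ := exists_injective_of_map_le (φ := φ) (ψ := ψ)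
    (Finset.univ : Finset (p.L.V ⊕ p.L.E)).nodup Finset.mem_univ
    (Finset.univ : Finset (G.V ⊕ G.E)).nodup (by
      rw [← hφ, ← hψ, h]
      exact Multiset.le_add_right _ _)
  have hV : ∀ x, ∃ y, i (.inl x) = .inl y := by
    intro x
    rcases hx : i (.inl x) with y | e
    · exact ⟨y, rfl⟩
    · have := hiφ (.inl x)
      rw [hx] at this
      exact (nodeAtom_ne_edgeAtom _ _ _ _ _ _ _ this.symm).elim
  have hE : ∀ x, ∃ y, i (.inr x) = .inr y := by
    intro x
    rcases hx : i (.inr x) with y | e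
    · have := hiφ (.inr x)
      rw [hx] at this
      exact (nodeAtom_ne_edgeAtom _ _ _ _ _ _ _ this).elim
    · exact ⟨e, rfl⟩
  choose mV hmV using hV
  choose mE hmE using hE
  have aV (x) := nodeAtom_inj.1 ((congrArg φ (hmV x)).symm.trans (hiφ (.inl x)))
  have aE (x) := edgeAtom_inj.1 ((congrArg φ (hmE x)).symm.trans (hiφ (.inr x)))
  let m : p.L ⟶ G :=
    { onV := mV
      onE := mE
      -- The edge constraint and the node constraint share the identifier of the source; injectivity
      -- of `idV` turns this into equality of nodes.
      src_comm := fun e => hid ((aV _).2.1.trans (aE e).2.2.1.symm)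
      tgt_comm := fun e => hid ((aV _).2.1.trans (aE e).2.2.2.symm)
      type_onV := fun x => (aV x).1
      type_onE := fun e => (aE e).1 }
  refine ⟨m, ⟨fun x y hxy => ?_, fun x y hxy => ?_⟩, fun x hx => ?_, fun x => (aV x).2.1.symm,
    fun e => (aE e).2.1.symm, fun x => ?_⟩
  · exact Sum.inl_injective (hi ((hmV x).trans ((congrArg Sum.inl hxy).trans (hmV y).symm)))
  · exact Sum.inr_injective (hi ((hmE x).trans ((congrArg Sum.inr hxy).trans (hmE y).symm)))
  · have := (aV x).2.2
    rw [if_neg hx] at this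
    exact_mod_cast hnum this
  · have := (aV (homV p.l x)).2.2
    rw [if_pos ⟨x, rfl⟩] at this
    exact this.symm

end Matching

/-! ### Semantics of states -/

section Semantics

variable {𝓛 : FirstOrder.Language.{u, v}} {Sig : Signature} {Var : Type w} {A : Type*}
  {M : Type*} [𝓛.Structure M]

theorem realize_congr {ν ν' : Var → M} (t : 𝓛.Term Var) (h : ∀ x ∈ termVars t, ν x = ν' x) :
    t.realize ν = t.realize ν' := by
  induction t with
  | var x => exact h x rfl
  | func f ts ih =>
    simp only [Term.realize]
    congr 1
    funext i
    exact ih i fun x hx => h x (Set.mem_iUnion.2 ⟨i, hx⟩)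

theorem realize_termSubst (ν : Var → M) {x : Var} {t : 𝓛.Term Var} (h : ν x = t.realize ν)
    (s : 𝓛.Term Var) : (termSubst x t s).realize ν = s.realize ν := by
  classical
  rw [termSubst, Term.realize_subst]
  congr 1
  funext y
  by_cases hy : y = x
  · subst hy; rw [Function.update_self, h]
  · rw [Function.update_of_ne hy]; rfl

theorem BuiltIn.holds_congr {ν ν' : Var → M} (b : BuiltIn 𝓛 Var) (h : ∀ x ∈ b.vars, ν x = ν' x) :
    b.Holds ν ↔ b.Holds ν' := by
  cases b with
  | eq s t =>
    simp only [Holds]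
    rw [realize_congr s fun x hx => h x (.inl hx), realize_congr t fun x hx => h x (.inr hx)]
  | rel R ts =>
    simp only [Holds]
    have : (fun i => (ts i).realize ν) = fun i => (ts i).realize ν' :=
      funext fun i => realize_congr _ fun x hx => h x (Set.mem_iUnion.2 ⟨i, hx⟩)
    rw [this]
  | top => rfl
  | bot => rfl

theorem BuiltIn.holds_rename (ν : Var → M) (ρ : Var → Var) (b : BuiltIn 𝓛 Var) :
    (b.rename ρ).Holds ν ↔ b.Holds (ν ∘ ρ) := by
  cases b <;> simp [rename, Holds]

theorem store_holds_congr {ν ν' : Var → M} (B : List (BuiltIn 𝓛 Var))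
    (h : ∀ x ∈ storeVars B, ν x = ν' x) :
    (∀ c ∈ B, c.Holds ν) ↔ ∀ c ∈ B, c.Holds ν' :=
  forall₂_congr fun c hc => c.holds_congr fun x hx => h x ⟨c, hc, hx⟩

/-- The image of a constraint under an interpretation of the terms. -/
def UserConstraint.atom (h : 𝓛.Term Var → A) (c : UserConstraint 𝓛 Sig Var) : Atom Sig A :=
  ⟨c.sym, fun i => h (c.args i)⟩

/-- Reduces equality of goals to the identities for atoms, with terms as arguments. -/
theorem UserConstraint.atom_id_injective :
    Function.Injective (UserConstraint.atom (Sig := Sig) (id : 𝓛.Term Var → _)) := by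
  rintro ⟨s, a⟩ ⟨s', a'⟩ h
  obtain ⟨rfl, h⟩ := Sigma.mk.inj_iff.1 h
  rw [UserConstraint.mk.injEq]
  exact ⟨rfl, h⟩

theorem UserConstraint.atom_realize_congr {ν ν' : Var → M} (c : UserConstraint 𝓛 Sig Var)
    (h : ∀ x ∈ c.vars, ν x = ν' x) :
    c.atom (fun t => t.realize ν) = c.atom fun t => t.realize ν' := by
  have : (fun i => (c.args i).realize ν) = fun i => (c.args i).realize ν' :=
    funext fun i => realize_congr _ fun x hx => h x (Set.mem_iUnion.2 ⟨i, hx⟩)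
  rw [atom, this, atom]

theorem goal_atom_congr {ν ν' : Var → M} (G : Multiset (UserConstraint 𝓛 Sig Var))
    (h : ∀ x ∈ goalVars G, ν x = ν' x) :
    G.map (UserConstraint.atom fun t => t.realize ν) =
      G.map (UserConstraint.atom fun t => t.realize ν') :=
  Multiset.map_congr rfl fun c hc => c.atom_realize_congr fun x hx => h x ⟨c, hc, hx⟩

/-- `T` is an instance of the goal of `σ` under a solution of the built-in store that agrees with
`μ` on the global variables. -/
def State.Realizes (σ : State 𝓛 Sig Var) (μ : Var → M) (T : Multiset (Atom Sig M)) : Prop :=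
  ∃ ν : Var → M, (∀ x ∈ σ.glob, ν x = μ x) ∧ (∀ c ∈ σ.store, c.Holds ν) ∧
    T = σ.goal.map (UserConstraint.atom fun t => t.realize ν)

variable {CT : ConstraintTheory 𝓛}

theorem StoreEquiv.realizes {M : Theory.ModelType.{u, v, max u v} CT.theory}
    {G : Multiset (UserConstraint 𝓛 Sig Var)} {B B' : List (BuiltIn 𝓛 Var)} {V : Set Var}
    (h : StoreEquiv CT (V ∪ goalVars G) B B') {μ : Var → M} {T : Multiset (Atom Sig M)}
    (hT : State.Realizes ⟨G, B, V⟩ μ T) : State.Realizes ⟨G, B', V⟩ μ T := by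
  obtain ⟨ν, hμ, hB, rfl⟩ := hT
  obtain ⟨ν', hν, hB'⟩ := (h M ν).1 ⟨ν, fun _ _ => rfl, hB⟩
  refine ⟨ν', fun x hx => (hν x (.inl hx)).trans (hμ x hx), hB', ?_⟩
  exact goal_atom_congr G fun x hx => (hν x (.inr hx)).symm

/-- Under a solution of `x = t`, the substitution `[x/t]` changes no value; equivalent stores have
the same solutions up to variables that are neither global nor in the goal; failed states have no
instances at all. -/
theorem EquivGen.realizes_iff {M : Theory.ModelType.{u, v, max u v} CT.theory}
    {σ τ : State 𝓛 Sig Var} (h : EquivGen CT σ τ) (μ : Var → M) (T : Multiset (Atom Sig M)) :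
    σ.Realizes μ T ↔ τ.Realizes μ T := by
  classical
  induction h with
  | subst G x t B V =>
    refine exists_congr fun ν => and_congr_right fun _ => and_congr_right fun hB => ?_
    have hx : ν x = t.realize ν := hB _ List.mem_cons_self
    have : (G.map (UserConstraint.subst x t)).map (UserConstraint.atom fun t => t.realize ν) =
        G.map (UserConstraint.atom fun t => t.realize ν) := by
      rw [Multiset.map_map]
      refine Multiset.map_congr rfl fun c _ => ?_
      simp only [Function.comp, UserConstraint.atom, UserConstraint.subst,
        realize_termSubst ν hx]
    simp only [this]
  | store G B B' V h => exact ⟨h.realizes, StoreEquiv.realizes fun M ν => (h M ν).symm⟩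
  | globals G B V x hG hB =>
    constructor
    · rintro ⟨ν, hμ, h⟩
      exact ⟨ν, fun y hy => hμ y (.inr hy), h⟩
    · rintro ⟨ν, hμ, hB', rfl⟩
      -- The variable `x` occurs neither in the goal nor in the store, so its value may be reset to
      -- the prescribed `μ x`.
      have hν : ∀ y ≠ x, ν y = Function.update ν x (μ x) y := fun y hy =>
        (Function.update_of_ne hy _ _).symm
      refine ⟨Function.update ν x (μ x), ?_, ?_, ?_⟩
      · rintro y hy
        by_cases hyx : y = x
        · subst hyx; exact Function.update_self ..
        · rw [← hν y hyx]
          exact hμ y (hy.resolve_left hyx)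
      · exact (store_holds_congr B fun y hy => hν y fun h => hB (h ▸ hy)).1 hB'
      · exact goal_atom_congr G fun y hy => hν y fun h => hG (h ▸ hy)
  | fail G G' V =>
    constructor <;> rintro ⟨ν, -, h, -⟩ <;> exact (h _ List.mem_cons_self).elim

theorem realizes_iff_of_cls_eq {M : Theory.ModelType.{u, v, max u v} CT.theory}
    {σ τ : State 𝓛 Sig Var} (h : σ.cls CT = τ.cls CT) (μ : Var → M)
    (T : Multiset (Atom Sig M)) : σ.Realizes μ T ↔ τ.Realizes μ T := by
  have h' : Relation.EqvGen (EquivGen CT) σ τ := Quotient.exact h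
  induction h' with
  | rel _ _ hgen => exact hgen.realizes_iff μ T
  | refl => rfl
  | symm _ _ _ ih => exact (ih (Quotient.sound ‹_›)).symm
  | trans _ _ _ h₁ h₂ ih₁ ih₂ =>
    exact (ih₁ (Quotient.sound h₁)).trans (ih₂ (Quotient.sound h₂))

end Semantics

/-! ### Integer constants in a model -/

section Numbers

variable {𝓛 : FirstOrder.Language.{u, v}} {CT : ConstraintTheory 𝓛}
  (M : Theory.ModelType.{u, v, max u v} CT.theory)

theorem ConstraintTheory.num_injective :
    Function.Injective fun z : ℤ => ((CT.num z : 𝓛.Constants) : M) := by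
  intro a b hab
  by_contra hne
  have := (CT.num_ne a b hne).realize_sentence M
  simp only [Sentence.Realize, Formula.Realize, BoundedFormula.realize_not,
    BoundedFormula.realize_bdEqual, Term.realize_constants] at this
  exact this hab

theorem ConstraintTheory.funMap_add (a b : ℤ) :
    Structure.funMap CT.add ![((CT.num a : 𝓛.Constants) : M), ((CT.num b : 𝓛.Constants) : M)] =
      ((CT.num (a + b) : 𝓛.Constants) : M) := by
  have := (CT.add_num a b).realize_sentence M
  simpa only [Sentence.Realize, Formula.Realize, BoundedFormula.realize_bdEqual,
    Term.realize_constants, Term.realize_functions_apply₂] using this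

theorem ConstraintTheory.funMap_sub (a b : ℤ) :
    Structure.funMap CT.sub ![((CT.num a : 𝓛.Constants) : M), ((CT.num b : 𝓛.Constants) : M)] =
      ((CT.num (a - b) : 𝓛.Constants) : M) := by
  have := (CT.sub_num a b).realize_sentence M
  simpa only [Sentence.Realize, Formula.Realize, BoundedFormula.realize_bdEqual,
    Term.realize_constants, Term.realize_functions_apply₂] using this

end Numbers

/-! ### The encoded rules -/

section Encoding

variable {𝓛 : FirstOrder.Language.{u, v}} {Var : Type w} {TG : Graph} {A : Type*}
  {CT : ConstraintTheory 𝓛}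

theorem atom_nodeC (h : 𝓛.Term Var → A) (G : TypedGraph TG) (x : G.V) (id d : 𝓛.Term Var) :
    (nodeC G x id d).atom h = nodeAtom (G.type.onV x) (h id) (h d) := by
  have : (fun i => h ((![id, d] : Fin 2 → 𝓛.Term Var) i)) = ![h id, h d] := by
    funext i; fin_cases i <;> rfl
  exact congrArg (Sigma.mk (β := fun s => Fin ((graphSig TG).ar s) → A)
    (Sum.inl (G.type.onV x))) this

theorem atom_edgeC (h : 𝓛.Term Var → A) (G : TypedGraph TG) (e : G.E) (id s t : 𝓛.Term Var) :
    (edgeC G e id s t).atom h = edgeAtom (G.type.onE e) (h id) (h s) (h t) := by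
  have : (fun i => h ((![id, s, t] : Fin 3 → 𝓛.Term Var) i)) = ![h id, h s, h t] := by
    funext i; fin_cases i <;> rfl
  exact congrArg (Sigma.mk (β := fun s => Fin ((graphSig TG).ar s) → A)
    (Sum.inr (G.type.onE e))) this

theorem map_filter_univ {B X : Type*} [Fintype B] (q : B → Prop) [DecidablePred q]
    [Fintype {b // q b}] (φ : B → X) :
    (Finset.univ.filter q).val.map φ =
      Multiset.map (fun b : {b // q b} => φ b) Finset.univ.val := by
  rw [← sum_singleton, ← sum_singleton, Finset.sum_subtype (p := q) _ (by simp)]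

theorem map_atom_chrHost (h : 𝓛.Term Var → A) (G : TypedGraph TG) (var : G.V ⊕ G.E → Var) :
    (chrHost CT G var).map (UserConstraint.atom h) =
      hostAtoms (fun z => h (CT.num z).term) G (fun x => h (.var (var (.inl x))))
        (fun e => h (.var (var (.inr e)))) := by
  rw [chrHost, hostAtoms, Multiset.map_add, Multiset.map_map, Multiset.map_map, sum_singleton,
    sum_singleton]
  congr 2
  · funext x; exact atom_nodeC ..
  · funext e; exact atom_edgeC ..

theorem map_atom_removed (h : 𝓛.Term Var → A) (p : Rule TG) (name : RuleVar p ↪ Var) :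
    (encodeRule CT p name).removed.map (UserConstraint.atom h) =
      headAtoms (fun z => h (CT.num z).term) p (fun y => h (.var (name y))) := by
  classical
  simp only [encodeRule, headAtoms, Multiset.map_add, Multiset.map_map,
    sum_singleton]
  congr 1
  · congr 1
    · congr 2
      · funext x; exact atom_nodeC ..
      · funext x; exact atom_edgeC ..
    · refine (map_filter_univ _ _).trans ?_
      congr 1
      funext x; exact atom_nodeC ..
  · refine (map_filter_univ _ _).trans ?_
    congr 1
    funext x; exact atom_edgeC ..

theorem map_atom_bodyU (h : 𝓛.Term Var → A) (p : Rule TG) (name : RuleVar p ↪ Var) :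
    (encodeRule CT p name).bodyU.map (UserConstraint.atom h) =
      bodyAtoms (fun z => h (CT.num z).term) p (fun y => h (.var (name y))) := by
  classical
  simp only [encodeRule, bodyAtoms, Multiset.map_add, Multiset.map_map,
    sum_singleton]
  congr 1
  · congr 1
    · congr 1
      · refine (map_filter_univ _ _).trans ?_
        congr 1
        funext x; exact atom_nodeC ..
      · refine (map_filter_univ _ _).trans ?_
        congr 1
        funext x; exact atom_edgeC ..
    · congr 1
      funext x; exact atom_edgeC ..
  · congr 1
    funext x; exact atom_nodeC ..

theorem relabel_constant {Var' : Type*} (ρ : Var → Var') (c : 𝓛.Constants) :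
    (c.term : 𝓛.Term Var).relabel ρ = c.term := by
  simp only [Constants.term, Term.relabel]
  congr 1
  funext i
  exact i.elim0

theorem subst_constant {Var' : Type*} (θ : Var → 𝓛.Term Var') (c : 𝓛.Constants) :
    (c.term : 𝓛.Term Var).subst θ = c.term := by
  simp only [Constants.term, Term.subst]
  congr 1
  funext i
  exact i.elim0

theorem termVars_constant (c : 𝓛.Constants) : termVars (c.term : 𝓛.Term Var) = ∅ := by
  simp [Constants.term, termVars]

/-- The renaming is absorbed into the interpretation of terms, `h` being replaced by its composite
with `relabel ρ`. -/
theorem map_atom_rename_removed (h : 𝓛.Term Var → A) (ρ : Var → Var) (p : Rule TG)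
    (name : RuleVar p ↪ Var) :
    ((encodeRule CT p name).rename ρ).removed.map (UserConstraint.atom h) =
      headAtoms (fun z => h (CT.num z).term) p (fun y => h (.var (ρ (name y)))) := by
  have := map_atom_removed (CT := CT) (fun t => h (t.relabel ρ)) p name
  simp only [relabel_constant, Term.relabel] at this
  rw [← this, CHRRule.rename, Multiset.map_map]
  rfl

theorem map_atom_rename_bodyU (h : 𝓛.Term Var → A) (ρ : Var → Var) (p : Rule TG)
    (name : RuleVar p ↪ Var) :
    ((encodeRule CT p name).rename ρ).bodyU.map (UserConstraint.atom h) =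
      bodyAtoms (fun z => h (CT.num z).term) p (fun y => h (.var (ρ (name y)))) := by
  have := map_atom_bodyU (CT := CT) (fun t => h (t.relabel ρ)) p name
  simp only [relabel_constant, Term.relabel] at this
  rw [← this, CHRRule.rename, Multiset.map_map]
  rfl

theorem store_holds_bodyB {M : Type*} [𝓛.Structure M] (ν : Var → M) (p : Rule TG)
    (name : RuleVar p ↪ Var) :
    (∀ c ∈ (encodeRule CT p name).bodyB, c.Holds ν) ↔ ∀ x : p.K.V,
      ν (name (.ofL (.inl (homV p.l x)))) = ν (name (.node' x)) ∧
      ν (name (.dvar' x)) = Structure.funMap CT.add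
        ![Structure.funMap CT.sub ![ν (name (.dvar (homV p.l x))),
          ((CT.num (p.L.deg (homV p.l x)) : 𝓛.Constants) : M)],
          ((CT.num (p.R.deg (homV p.r x)) : 𝓛.Constants) : M)] := by
  simp [encodeRule, BuiltIn.Holds, Term.realize_constants, or_imp, forall_and]

end Encoding

/-! ### Variables of encoded rules -/

section Vars

variable {𝓛 : FirstOrder.Language.{u, v}} {Sig : Signature} {Var : Type w}

theorem termVars_relabel (ρ : Var → Var) (t : 𝓛.Term Var) :
    termVars (t.relabel ρ) = ρ '' termVars t := by
  induction t with
  | var x => simp [termVars]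
  | func f ts ih => simp [termVars, ih, Set.image_iUnion]

theorem BuiltIn.vars_rename (ρ : Var → Var) (b : BuiltIn 𝓛 Var) :
    (b.rename ρ).vars = ρ '' b.vars := by
  cases b <;> simp [rename, vars, termVars_relabel, Set.image_union, Set.image_iUnion]

theorem UserConstraint.vars_rename (ρ : Var → Var) (c : UserConstraint 𝓛 Sig Var) :
    (c.rename ρ).vars = ρ '' c.vars := by
  simp [rename, vars, termVars_relabel, Set.image_iUnion]

theorem goalVars_rename (ρ : Var → Var) (G : Multiset (UserConstraint 𝓛 Sig Var)) :
    goalVars (G.map (UserConstraint.rename ρ)) = ρ '' goalVars G := by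
  ext x
  simp only [goalVars, Multiset.mem_map, Set.mem_ofPred_eq, Set.mem_image]
  constructor
  · rintro ⟨_, ⟨c, hc, rfl⟩, hx⟩
    rw [UserConstraint.vars_rename] at hx
    obtain ⟨y, hy, rfl⟩ := hx
    exact ⟨y, ⟨c, hc, hy⟩, rfl⟩
  · rintro ⟨y, ⟨c, hc, hy⟩, rfl⟩
    exact ⟨_, ⟨c, hc, rfl⟩, by rw [UserConstraint.vars_rename]; exact ⟨y, hy, rfl⟩⟩

theorem storeVars_rename (ρ : Var → Var) (B : List (BuiltIn 𝓛 Var)) :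
    storeVars (B.map (BuiltIn.rename ρ)) = ρ '' storeVars B := by
  ext x
  simp only [storeVars, List.mem_map, Set.mem_ofPred_eq, Set.mem_image]
  constructor
  · rintro ⟨_, ⟨c, hc, rfl⟩, hx⟩
    rw [BuiltIn.vars_rename] at hx
    obtain ⟨y, hy, rfl⟩ := hx
    exact ⟨y, ⟨c, hc, hy⟩, rfl⟩
  · rintro ⟨y, ⟨c, hc, hy⟩, rfl⟩
    exact ⟨_, ⟨c, hc, rfl⟩, by rw [BuiltIn.vars_rename]; exact ⟨y, hy, rfl⟩⟩

theorem CHRRule.headVars_rename (ρ : Var → Var) (r : CHRRule 𝓛 Sig Var) :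
    (r.rename ρ).headVars = ρ '' r.headVars := by
  simp only [headVars, rename, goalVars_rename, storeVars_rename, Set.image_union]

theorem CHRRule.vars_rename (ρ : Var → Var) (r : CHRRule 𝓛 Sig Var) :
    (r.rename ρ).vars = ρ '' r.vars := by
  rw [vars, headVars_rename, vars]
  simp only [rename, goalVars_rename, storeVars_rename, Set.image_union]

/-- With `termVars` as the interpretation of terms, the variables of an encoding can be read off
from the formulas for its atoms. -/
theorem mem_goalVars_iff {x : Var} {G : Multiset (UserConstraint 𝓛 Sig Var)} :
    x ∈ goalVars G ↔ ∃ α ∈ G.map (UserConstraint.atom termVars), ∃ i, x ∈ α.2 i := by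
  simp [goalVars, UserConstraint.vars, UserConstraint.atom]

variable {TG : Graph} {p : Rule TG}

theorem exists_mem_nodeAtom {t : TG.V} {a b : Set Var} {x : Var} :
    (∃ i, x ∈ (nodeAtom t a b).2 i) ↔ x ∈ a ∨ x ∈ b :=
  Fin.exists_fin_two (p := fun i => x ∈ (![a, b] : Fin 2 → Set Var) i)

theorem exists_mem_edgeAtom {t : TG.E} {a b c : Set Var} {x : Var} :
    (∃ i, x ∈ (edgeAtom t a b c).2 i) ↔ x ∈ a ∨ x ∈ b ∨ x ∈ c := by
  have := Fin.exists_fin_succ (P := fun i => x ∈ (![a, b, c] : Fin 3 → Set Var) i)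
  rw [Fin.exists_fin_two] at this
  exact this

/-- The variables in the head of an encoded rule. -/
def RuleVar.IsHead : RuleVar p → Prop
  | .ofL _ => True
  | .dvar x => x ∈ Set.range (homV p.l)
  | _ => False

/-- The variables of an encoded rule that occur only in its body. -/
def RuleVar.IsBody : RuleVar p → Prop
  | .ofL _ => False
  | .dvar _ => False
  | _ => True

theorem RuleVar.not_isHead_of_isBody {y : RuleVar p} (h : y.IsBody) : ¬ y.IsHead := by
  cases y <;> simp_all [IsHead, IsBody]

theorem RuleVar.ofR_isHead_or_isBody (x : p.R.V ⊕ p.R.E) :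
    (RuleVar.ofR p x).IsHead ∨ (RuleVar.ofR p x).IsBody := by
  rcases x with x | x <;> rw [RuleVar.ofR] <;> split_ifs <;> simp [IsHead, IsBody]

variable (CT : ConstraintTheory 𝓛) (name : RuleVar p ↪ Var)

theorem headVars_encodeRule :
    (encodeRule CT p name).headVars = name '' {y | y.IsHead} := by
  classical
  have h₀ : goalVars (encodeRule CT p name).kept = ∅ := by simp [encodeRule, goalVars]
  have h₁ : storeVars (encodeRule CT p name).guard = ∅ := by simp [encodeRule, storeVars]
  rw [CHRRule.headVars, h₀, h₁, Set.empty_union, Set.union_empty]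
  ext v
  rw [mem_goalVars_iff, map_atom_removed, headAtoms_eq]
  simp only [Multiset.mem_add, Multiset.mem_sum, Finset.mem_univ, true_and,
    Multiset.mem_singleton, or_and_right, exists_or, ← exists_and_right]
  constructor
  · rintro (⟨_, x, rfl, h⟩ | ⟨_, e, rfl, h⟩)
    · rw [exists_mem_nodeAtom] at h
      rcases h with h | h
      · exact ⟨.ofL (.inl x), trivial, h.symm⟩
      -- A deleted node carries a constant as its degree, so its `dvar` does not occur in the head.
      · split_ifs at h with hx
        · exact ⟨.dvar x, hx, h.symm⟩
        · rw [termVars_constant] at h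
          exact h.elim
    · rw [exists_mem_edgeAtom] at h
      rcases h with h | h | h
      · exact ⟨.ofL (.inr e), trivial, h.symm⟩
      · exact ⟨.ofL (.inl _), trivial, h.symm⟩
      · exact ⟨.ofL (.inl _), trivial, h.symm⟩
  · rintro ⟨y, hy, rfl⟩
    match y, hy with
    | .ofL (.inl x), _ => exact .inl ⟨_, x, rfl, exists_mem_nodeAtom.2 (.inl rfl)⟩
    | .ofL (.inr e), _ => exact .inr ⟨_, e, rfl, exists_mem_edgeAtom.2 (.inl rfl)⟩
    | .dvar x, hx =>
      refine .inl ⟨_, x, rfl, exists_mem_nodeAtom.2 (.inr ?_)⟩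
      rw [if_pos (show x ∈ Set.range (homV p.l) from hx)]
      rfl

theorem isHead_or_isBody_of_mem_vars {v : Var} (h : v ∈ (encodeRule CT p name).vars) :
    ∃ y : RuleVar p, (y.IsHead ∨ y.IsBody) ∧ name y = v := by
  classical
  rcases h with (h | h) | h
  · rw [headVars_encodeRule] at h
    obtain ⟨y, hy, rfl⟩ := h
    exact ⟨y, .inl hy, rfl⟩
  · rw [mem_goalVars_iff, map_atom_bodyU, bodyAtoms] at h
    obtain ⟨α, hα, h⟩ := h
    simp only [Multiset.mem_add, Multiset.mem_sum, Finset.mem_univ, true_and,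
      Multiset.mem_singleton] at hα
    have hR (x) (h : v ∈ termVars (Term.var (name (RuleVar.ofR p x)) : 𝓛.Term Var)) :
        ∃ y : RuleVar p, (y.IsHead ∨ y.IsBody) ∧ name y = v :=
      ⟨_, RuleVar.ofR_isHead_or_isBody x, h.symm⟩
    rcases hα with ((⟨x, rfl⟩ | ⟨x, rfl⟩) | ⟨x, rfl⟩) | ⟨x, rfl⟩
    · rw [exists_mem_nodeAtom, termVars_constant] at h
      exact hR _ (h.resolve_right id)
    · rw [exists_mem_edgeAtom] at h
      rcases h with h | h | h <;> exact hR _ h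
    · rw [exists_mem_edgeAtom] at h
      rcases h with h | h | h <;> exact hR _ h
    · rw [exists_mem_nodeAtom] at h
      rcases h with h | h
      · exact ⟨.node' x, .inr trivial, h.symm⟩
      · exact ⟨.dvar' x, .inr trivial, h.symm⟩
  · obtain ⟨c, hc, hv⟩ := h
    simp only [encodeRule, List.mem_flatMap, Finset.mem_toList, Finset.mem_univ, true_and,
      List.mem_cons, List.not_mem_nil, or_false] at hc
    obtain ⟨x, rfl | rfl⟩ := hc
    · rcases hv with h | h
      · exact ⟨.ofL _, .inl trivial, h.symm⟩
      · exact ⟨.node' x, .inr trivial, h.symm⟩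
    · rcases hv with h | h
      · exact ⟨.dvar' x, .inr trivial, h.symm⟩
      · simp only [Functions.apply₂, termVars, Set.mem_iUnion, Fin.exists_fin_two,
          Matrix.cons_val_zero, Matrix.cons_val_one, termVars_constant] at h
        exact ⟨.dvar _, .inl ⟨x, rfl⟩, ((h.resolve_right id).resolve_right id).symm⟩

theorem mem_vars_encodeRule_of_isBody {y : RuleVar p} (hy : y.IsBody) :
    name y ∈ (encodeRule CT p name).vars := by
  classical
  refine .inl (.inr ?_)
  rw [mem_goalVars_iff, map_atom_bodyU, bodyAtoms]
  simp only [Multiset.mem_add, Multiset.mem_sum, Finset.mem_univ, true_and,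
    Multiset.mem_singleton]
  match y, hy with
  | .newNode x hx, _ =>
    refine ⟨_, .inl (.inl (.inl ⟨⟨x, hx⟩, rfl⟩)), exists_mem_nodeAtom.2 (.inl ?_)⟩
    rw [RuleVar.ofR_inl_of_notMem p hx]; rfl
  | .newEdge e he, _ =>
    refine ⟨_, .inl (.inl (.inr ⟨⟨e, he⟩, rfl⟩)), exists_mem_edgeAtom.2 (.inl ?_)⟩
    rw [RuleVar.ofR_inr_of_notMem p he]; rfl
  | .node' x, _ => exact ⟨_, .inr ⟨x, rfl⟩, exists_mem_nodeAtom.2 (.inl rfl)⟩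
  | .dvar' x, _ => exact ⟨_, .inr ⟨x, rfl⟩, exists_mem_nodeAtom.2 (.inr rfl)⟩

theorem vars_encodeRule :
    (encodeRule CT p name).vars = name '' {y | y.IsHead ∨ y.IsBody} := by
  refine Set.Subset.antisymm (fun v hv => isHead_or_isBody_of_mem_vars CT name hv) ?_
  rintro _ ⟨y, hy | hy, rfl⟩
  · refine .inl (.inl ?_)
    rw [headVars_encodeRule]
    exact ⟨y, hy, rfl⟩
  · exact mem_vars_encodeRule_of_isBody CT name hy

end Vars

/-! ### CHR steps of ground instances are transformation steps -/

section Ground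

variable {𝓛 : FirstOrder.Language.{u, v}} {Var : Type w} {TG : Graph} {CT : ConstraintTheory 𝓛}
  {M : Theory.ModelType.{u, v, max u v} CT.theory}

/-- An injective choice of elements outside of a finite set. -/
theorem exists_injective_notMem_range {B C X : Type*} [Finite B] [Finite C] [Infinite X]
    (i : C → X) : ∃ j : B → X, Function.Injective j ∧ ∀ b c, j b ≠ i c := by
  have : Infinite ((Set.range i)ᶜ : Set X) := (Set.finite_range i).infinite_compl.to_subtype
  obtain ⟨n, ⟨e⟩⟩ := Finite.exists_equiv_fin B
  let j : B → ((Set.range i)ᶜ : Set X) := fun b => Infinite.natEmbedding _ (e b : ℕ)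
  refine ⟨fun b => j b, fun a b hab => ?_, fun b c h => (j b).2 ⟨c, h.symm⟩⟩
  exact e.injective (Fin.ext ((Infinite.natEmbedding _).injective (Subtype.ext hab)))

/-- The encoding of a graph with arguments in a model of the constraint theory. -/
noncomputable abbrev groundAtoms (M : Theory.ModelType.{u, v, max u v} CT.theory)
    (G : TypedGraph TG) (idV : G.V → M) (idE : G.E → M) : Multiset (Atom (graphSig TG) M) :=
  hostAtoms (fun z => ((CT.num z : 𝓛.Constants) : M)) G idV idE

theorem map_atom_realize_removed (ν : Var → M) (ρ : Var → Var) (p : Rule TG)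
    (name : RuleVar p ↪ Var) :
    ((encodeRule CT p name).rename ρ).removed.map (UserConstraint.atom fun t => t.realize ν) =
      headAtoms (fun z => ((CT.num z : 𝓛.Constants) : M)) p fun y => ν (ρ (name y)) := by
  simp only [map_atom_rename_removed, Term.realize_constants, Term.realize_var]

theorem map_atom_realize_bodyU (ν : Var → M) (ρ : Var → Var) (p : Rule TG)
    (name : RuleVar p ↪ Var) :
    ((encodeRule CT p name).rename ρ).bodyU.map (UserConstraint.atom fun t => t.realize ν) =
      bodyAtoms (fun z => ((CT.num z : 𝓛.Constants) : M)) p fun y => ν (ρ (name y)) := by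
  simp only [map_atom_rename_bodyU, Term.realize_constants, Term.realize_var]

theorem store_holds_rename_bodyB (ν : Var → M) (ρ : Var → Var) (p : Rule TG)
    (name : RuleVar p ↪ Var) :
    (∀ c ∈ ((encodeRule CT p name).rename ρ).bodyB, c.Holds ν) ↔
      ∀ c ∈ (encodeRule CT p name).bodyB, c.Holds (ν ∘ ρ) := by
  simp [CHRRule.rename, BuiltIn.holds_rename]

/-- The values of the variables of a rule after a transformation. -/
def RuleVar.update {A : Type*} {p : Rule TG} (a : RuleVar p → A) (new : p.R.V → A)
    (deg : p.K.V → A) : RuleVar p → A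
  | .newNode x _ => new x
  | .node' x => a (.ofL (.inl (homV p.l x)))
  | .dvar' x => deg x
  | y => a y

theorem RuleVar.update_of_isHead {A : Type*} {p : Rule TG} {a : RuleVar p → A} {new : p.R.V → A}
    {deg : p.K.V → A} {y : RuleVar p} (hy : y.IsHead) : RuleVar.update a new deg y = a y :=
  match y, hy with
  | .ofL _, _ => rfl
  | .dvar _, _ => rfl

/-- In an instance, the arbitrary store `B` matters only through one of its solutions, so it need
not be analysed how `B` binds or identifies the head variables. -/
theorem exists_dpo_of_realizes {p : Rule TG} {name : RuleVar p ↪ Var} {ρ : Var → Var}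
    (hρ : Set.InjOn ρ (encodeRule CT p name).vars)
    {T : Multiset (UserConstraint 𝓛 (graphSig TG) Var)} {B : List (BuiltIn 𝓛 Var)} {V : Set Var}
    (hfresh : ((encodeRule CT p name).rename ρ).Fresh T B V) {G : TypedGraph TG} {idV : G.V → M}
    (hid : Function.Injective idV) {idE : G.E → M} {μ : Var → M}
    (h : State.Realizes ⟨((encodeRule CT p name).rename ρ).kept +
      ((encodeRule CT p name).rename ρ).removed + T,
      ((encodeRule CT p name).rename ρ).guard ++ B, V⟩ μ (groundAtoms M G idV idE)) :
    ∃ (H : TypedGraph TG) (idV' : H.V → M) (idE' : H.E → M), Function.Injective idV' ∧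
      (∃ m : p.L ⟶ G, IsInjective m ∧ DPO p m H) ∧
      State.Realizes ⟨((encodeRule CT p name).rename ρ).kept +
        ((encodeRule CT p name).rename ρ).bodyU + T,
        ((encodeRule CT p name).rename ρ).guard ++ ((encodeRule CT p name).rename ρ).bodyB ++ B,
        V⟩ μ (groundAtoms M H idV' idE') := by
  classical
  have hnum := ConstraintTheory.num_injective (CT := CT) M
  have : Infinite M := Infinite.of_injective _ hnum
  have hkept : ((encodeRule CT p name).rename ρ).kept = 0 := rfl
  have hguard : ((encodeRule CT p name).rename ρ).guard = [] := rfl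
  rw [hkept, hguard, zero_add, List.nil_append] at h ⊢
  obtain ⟨ν, hμ, hB, hT⟩ := h
  dsimp only at hμ hB hT
  rw [Multiset.map_add, map_atom_realize_removed, groundAtoms] at hT
  set a : RuleVar p → M := fun y => ν (ρ (name y)) with ha
  obtain ⟨m, hm, hdeg, haV, haE, had⟩ := exists_match hnum hid hT
  obtain ⟨D, k, f, hL⟩ := exists_isGluedSquare p.l_inj hm hdeg
  obtain ⟨H, n, g, hR⟩ := exists_isGluedSquare_of_span p.r k p.r_inj hL.top_inj
  -- Both sides contain the instance of the head; cancelling it shows that `T` is instantiated to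
  -- the context.
  rw [hostAtoms_eq_headAtoms_add hL haV haE had] at hT
  have hT := add_left_cancel hT
  -- Created nodes get identifiers outside of those of `G`, which keeps `idV'` injective. Created
  -- edges keep whatever value `ν` gives them, since matches of edges are separated by multiplicity.
  obtain ⟨new, hnew, hnew'⟩ := exists_injective_notMem_range (B := p.R.V) idV
  let a' : RuleVar p → M := RuleVar.update a new fun x =>
    ((CT.num (H.deg (homV n (homV p.r x))) : 𝓛.Constants) : M)
  let e : {y : RuleVar p // y.IsBody} → Var := fun y => ρ (name y)
  have hmem (y : RuleVar p) (hy : y.IsHead ∨ y.IsBody) :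
      name y ∈ (encodeRule CT p name).vars := by
    rw [vars_encodeRule]; exact ⟨y, hy, rfl⟩
  have he : Function.Injective e := fun y z hyz => Subtype.ext <| name.injective <|
    hρ (hmem y (.inr y.2)) (hmem z (.inr z.2)) hyz
  -- Only the variables that occur in the body alone get new values. Freshness keeps them out of
  -- `T`, `V` and `B`, so all earlier conditions survive.
  let ν' : Var → M := Function.extend e (fun y => a' y) ν
  have hν_of_not (v : Var) (hv : ∀ y : RuleVar p, y.IsBody → ρ (name y) ≠ v) : ν' v = ν v :=
    Function.extend_apply' _ _ _ fun ⟨y, hy⟩ => hv y y.2 hy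
  have hν_body (y : RuleVar p) (hy : y.IsBody) : ν' (ρ (name y)) = a' y :=
    he.extend_apply (fun y => a' y) ν ⟨y, hy⟩
  have hν_head (y : RuleVar p) (hy : y.IsHead) : ν' (ρ (name y)) = a y := by
    refine hν_of_not _ fun z hz hzy => ?_
    have := name.injective (hρ (hmem z (.inr hz)) (hmem y (.inl hy)) hzy)
    exact RuleVar.not_isHead_of_isBody hz (this ▸ hy)
  have hbody (y : RuleVar p) (hy : y.IsBody) :
      ρ (name y) ∈ ((encodeRule CT p name).rename ρ).vars := by
    rw [CHRRule.vars_rename]; exact ⟨_, hmem y (.inr hy), rfl⟩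
  have hbody' (y : RuleVar p) (hy : y.IsBody) :
      ρ (name y) ∉ ((encodeRule CT p name).rename ρ).headVars := by
    rw [CHRRule.headVars_rename, headVars_encodeRule]
    rintro ⟨_, ⟨z, hz, rfl⟩, h⟩
    have := name.injective (hρ (hmem z (.inl hz)) (hmem y (.inr hy)) h)
    exact RuleVar.not_isHead_of_isBody hy (this ▸ hz)
  have hνT : ∀ v ∈ goalVars T, ν' v = ν v := fun v hv => hν_of_not v fun y hy h =>
    Set.disjoint_left.1 hfresh.1 (hbody y hy) (h ▸ .inl hv)
  have hνV : ∀ v ∈ V, ν' v = ν v := fun v hv => hν_of_not v fun y hy h =>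
    Set.disjoint_left.1 hfresh.1 (hbody y hy) (h ▸ .inr hv)
  have hνB : ∀ v ∈ storeVars B, ν' v = ν v := fun v hv => hν_of_not v fun y hy h =>
    Set.disjoint_left.1 hfresh.2 ⟨hbody y hy, hbody' y hy⟩ (h ▸ hv)
  have hνR (x) : ν' (ρ (name (RuleVar.ofR p x))) = a' (RuleVar.ofR p x) := by
    rcases RuleVar.ofR_isHead_or_isBody x with h | h
    · exact (hν_head _ h).trans (RuleVar.update_of_isHead h).symm
    · exact hν_body _ h
  have compV (x) : a' (.ofR p (.inl (homV p.r x))) = idV (homV f (homV k x)) := by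
    rw [RuleVar.ofR_inl, ← hL.commV, ← haV]; rfl
  have compE (x) : a' (.ofR p (.inr (homE p.r x))) = idE (homE f (homE k x)) := by
    rw [RuleVar.ofR_inr, ← hL.commE, ← haE]; rfl
  let idV' : H.V → M := hR.gluingV.desc (fun x => a' (.ofR p (.inl x))) fun d => idV (homV f d)
  let idE' : H.E → M := hR.gluingE.desc (fun x => a' (.ofR p (.inr x))) fun d => idE (homE f d)
  have hidV_g (d) : idV' (homV g d) = idV (homV f d) := hR.gluingV.desc_left ..
  have hidE_g (d) : idE' (homE g d) = idE (homE f d) := hR.gluingE.desc_left ..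
  have hidV_n (x) : idV' (homV n x) = a' (.ofR p (.inl x)) :=
    hR.gluingV.desc_right hR.commV compV x
  have hidE_n (x) : idE' (homE n x) = a' (.ofR p (.inr x)) :=
    hR.gluingE.desc_right hR.commE compE x
  have hnewN (x) (hx : x ∉ Set.range (homV p.r)) : idV' (homV n x) = new x := by
    rw [hidV_n, RuleVar.ofR_inl_of_notMem p hx]; rfl
  refine ⟨H, idV', idE', ?_, ⟨m, hm, D, k, n, f, g, hL.isPushout, hR.isPushout⟩, ν', ?_, ?_, ?_⟩
  · intro x y hxy
    rcases hR.gluingV.cases x with ⟨d, rfl⟩ | ⟨x, hx, rfl⟩ <;>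
      rcases hR.gluingV.cases y with ⟨d', rfl⟩ | ⟨y, hy, rfl⟩
    · rw [hidV_g, hidV_g] at hxy
      rw [hL.gluingV.injective (hid hxy)]
    · rw [hidV_g, hnewN y hy] at hxy
      exact (hnew' _ _ hxy.symm).elim
    · rw [hidV_g, hnewN x hx] at hxy
      exact (hnew' _ _ hxy).elim
    · rw [hnewN x hx, hnewN y hy] at hxy
      rw [hnew hxy]
  · exact fun v hv => (hνV v hv).trans (hμ v hv)
  · simp only [List.forall_mem_append]
    refine ⟨?_, (store_holds_congr B hνB).2 hB⟩
    rw [store_holds_rename_bodyB, store_holds_bodyB]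
    intro x
    simp only [Function.comp_apply]
    rw [hν_head (.ofL _) trivial, hν_body (.node' x) trivial, hν_body (.dvar' x) trivial,
      hν_head (.dvar (homV p.l x)) ⟨x, rfl⟩, had, ConstraintTheory.funMap_sub,
      ConstraintTheory.funMap_add, ← deg_transform hL hR]
    exact ⟨rfl, rfl⟩
  · rw [Multiset.map_add, map_atom_realize_bodyU, goal_atom_congr T hνT, ← hT, groundAtoms,
      hostAtoms_eq_bodyAtoms_add hR (a := fun y => ν' (ρ (name y)))]
    · simp only [hidV_g, hidE_g]
    · exact fun x => (hνR _).trans (hidV_n x).symm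
    · exact fun x => (hνR _).trans (hidE_n x).symm
    · intro x
      rw [hν_body (.node' x) trivial, hidV_n, RuleVar.ofR_inl]
      rfl
    · exact fun x => hν_body (.dvar' x) trivial

variable (CT) in
theorem ConstraintTheory.exists_model :
    Nonempty (Theory.ModelType.{u, v, max u v} CT.theory) := CT.complete.1

/-- The class `q` has the encoding of `G` among its instances in `M`. -/
def ClassEncodes (M : Theory.ModelType.{u, v, max u v} CT.theory)
    (q : StateClass CT (graphSig TG) Var) (G : TypedGraph TG) : Prop :=
  ∃ σ : State 𝓛 (graphSig TG) Var, σ.cls CT = q ∧ ∃ (μ : Var → M) (idV : G.V → M) (idE : G.E → M),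
    Function.Injective idV ∧ σ.Realizes μ (groundAtoms M G idV idE)

theorem ClassEncodes.exists_step {S : GTS} {name : ∀ p : Rule S.TG, RuleVar p ↪ Var}
    {q q' : StateClass CT (graphSig S.TG) Var} {G : TypedGraph S.TG} (h : ClassEncodes M q G)
    (hq : CHRStep CT (S.toCHR CT name) q q') : ∃ H, S.Step G H ∧ ClassEncodes M q' H := by
  obtain ⟨σ, rfl, μ, idV, idE, hid, hσ⟩ := h
  obtain ⟨_, ⟨p, hp, rfl⟩, _, ⟨ρ, hρ, rfl⟩, T, B, V, hfresh, hcls, rfl⟩ := hq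
  rw [realizes_iff_of_cls_eq hcls] at hσ
  obtain ⟨H, idV', idE', hid', hstep, hH⟩ := exists_dpo_of_realizes hρ hfresh hid hσ
  exact ⟨H, ⟨p, hp, hstep⟩, _, rfl, μ, idV', idE', hid', hH⟩

/-- The encoding of `G` has an instance with different identifiers, hence so does the equivalent
state with store `σ.store ++ B`. A solution of this store solves `σ.store`, so `B` can be forgotten.
-/
theorem GraphInvariant.exists_classEncodes {σ : State 𝓛 (graphSig TG) Var}
    (h : GraphInvariant CT σ) (M : Theory.ModelType.{u, v, max u v} CT.theory) :
    ∃ G, ClassEncodes M (σ.cls CT) G := by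
  obtain ⟨-, G, var, B, -, hcls⟩ := h
  have : Infinite M := Infinite.of_injective _ (ConstraintTheory.num_injective (CT := CT) M)
  obtain ⟨j, hj, -⟩ := exists_injective_notMem_range (B := G.V ⊕ G.E) (C := Empty) (X := M)
    Empty.elim
  let x₀ : M := ((CT.num 0 : 𝓛.Constants) : M)
  let ν : Var → M := Function.extend var j fun _ => x₀
  have hν (y) : ν (var y) = j y := var.injective.extend_apply _ _ _
  have h₀ : State.Realizes ⟨chrHost CT G var, [], ∅⟩ ν
      (groundAtoms M G (fun x => j (.inl x)) fun e => j (.inr e)) := by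
    refine ⟨ν, fun _ _ => rfl, by simp, ?_⟩
    rw [map_atom_chrHost]
    simp only [Term.realize_constants, Term.realize_var, hν]
  obtain ⟨ν₁, -, hB, hT⟩ := (realizes_iff_of_cls_eq hcls ν _).2 h₀
  -- The invariant compares states without global variables, whereas `σ` may have some; their values
  -- are prescribed to be those of the solution `ν₁`.
  exact ⟨G, σ, rfl, ν₁, _, _, hj.comp Sum.inl_injective, ν₁, fun _ _ => rfl,
    fun c hc => hB c (List.mem_append_left _ hc), hT⟩

/-- An infinite sequence along which an invariant can be followed. -/
theorem exists_seq {Q X : Type*} {P : Q → X → Prop} {R : X → X → Prop} {s : ℕ → Q} {x₀ : X}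
    (h₀ : P (s 0) x₀) (h : ∀ i x, P (s i) x → ∃ y, R x y ∧ P (s (i + 1)) y) :
    ∃ f : ℕ → X, f 0 = x₀ ∧ ∀ i, R (f i) (f (i + 1)) := by
  choose next hR hP using h
  let F : ∀ i, {x // P (s i) x} := fun i =>
    Nat.rec ⟨x₀, h₀⟩ (fun i x => ⟨next i x.1 x.2, hP i x.1 x.2⟩) i
  exact ⟨fun i => (F i).1, rfl, fun i => hR i (F i).1 (F i).2⟩

theorem GTS.Terminating.gTerminating {S : GTS} (hS : S.Terminating)
    (name : ∀ p : Rule S.TG, RuleVar p ↪ Var) : GTerminating CT (S.toCHR CT name) := by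
  rintro σ hσ ⟨s, hs, hstep⟩
  obtain ⟨M⟩ := CT.exists_model
  obtain ⟨G, hG⟩ := hσ.exists_classEncodes M
  obtain ⟨f, -, hf⟩ :=
    exists_seq (P := ClassEncodes M) (hs ▸ hG) fun i _ h => h.exists_step (hstep i)
  exact hS ⟨f, hf⟩

end Ground

/-! ### Elimination of solved built-in stores -/

section Solved

variable {𝓛 : FirstOrder.Language.{u, v}} {Sig : Signature} {Var : Type w}
  {CT : ConstraintTheory 𝓛}

theorem subst_congr {θ θ' : Var → 𝓛.Term Var} (t : 𝓛.Term Var)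
    (h : ∀ x ∈ termVars t, θ x = θ' x) : t.subst θ = t.subst θ' := by
  induction t with
  | var x => exact h x rfl
  | func f ts ih =>
    simp only [Term.subst]
    congr 1
    funext i
    exact ih i fun x hx => h x (Set.mem_iUnion.2 ⟨i, hx⟩)

theorem subst_var (t : 𝓛.Term Var) : t.subst Term.var = t := by
  induction t with
  | var x => rfl
  | func f ts ih =>
    simp only [Term.subst]
    congr 1
    funext i
    exact ih i

theorem subst_subst (θ θ' : Var → 𝓛.Term Var) (t : 𝓛.Term Var) :
    (t.subst θ).subst θ' = t.subst fun x => (θ x).subst θ' := by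
  induction t with
  | var x => rfl
  | func f ts ih =>
    simp only [Term.subst]
    congr 1
    funext i
    exact ih i

theorem mem_termVars_subst {θ : Var → 𝓛.Term Var} {t : 𝓛.Term Var} {y : Var} :
    y ∈ termVars (t.subst θ) ↔ ∃ x ∈ termVars t, y ∈ termVars (θ x) := by
  induction t with
  | var x => simp [termVars, Term.subst]
  | func f ts ih =>
    simp only [Term.subst, termVars, Set.mem_iUnion, ih]
    constructor
    · rintro ⟨i, x, hx, hy⟩; exact ⟨x, ⟨i, hx⟩, hy⟩
    · rintro ⟨x, ⟨i, hx⟩, hy⟩; exact ⟨i, x, hx, hy⟩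

/-- The simultaneous substitution on user-defined constraints. -/
def UserConstraint.substAll (θ : Var → 𝓛.Term Var) (c : UserConstraint 𝓛 Sig Var) :
    UserConstraint 𝓛 Sig Var := ⟨c.sym, fun i => (c.args i).subst θ⟩

theorem UserConstraint.substAll_congr {θ θ' : Var → 𝓛.Term Var} (c : UserConstraint 𝓛 Sig Var)
    (h : ∀ x ∈ c.vars, θ x = θ' x) : c.substAll θ = c.substAll θ' := by
  have : (fun i => (c.args i).subst θ) = fun i => (c.args i).subst θ' :=
    funext fun i => subst_congr _ fun x hx => h x (Set.mem_iUnion.2 ⟨i, hx⟩)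
  rw [substAll, this, substAll]

theorem UserConstraint.substAll_var (c : UserConstraint 𝓛 Sig Var) : c.substAll Term.var = c := by
  simp only [substAll, subst_var]

theorem cls_eq_of_storeEquiv {G : Multiset (UserConstraint 𝓛 Sig Var)}
    {B B' : List (BuiltIn 𝓛 Var)} {V : Set Var} (h : StoreEquiv CT (V ∪ goalVars G) B B') :
    State.cls CT ⟨G, B, V⟩ = State.cls CT ⟨G, B', V⟩ :=
  Quotient.sound (.rel _ _ (.store G B B' V h))

theorem storeEquiv_of_forall_iff {fixed : Set Var} {B B' : List (BuiltIn 𝓛 Var)}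
    (h : ∀ (M : Theory.ModelType.{u, v, max u v} CT.theory) (ν : Var → M),
      (∀ c ∈ B, c.Holds ν) ↔ ∀ c ∈ B', c.Holds ν) : StoreEquiv CT fixed B B' := fun M _ =>
  exists_congr fun ν' => and_congr_right fun _ => h M ν'

/-- A variable may be replaced by a term if the store entails their equality. -/
theorem cls_subst_of_entails {B : List (BuiltIn 𝓛 Var)} {x : Var} {t : 𝓛.Term Var}
    (h : ∀ (M : Theory.ModelType.{u, v, max u v} CT.theory) (ν : Var → M),
      (∀ c ∈ B, c.Holds ν) → ν x = t.realize ν)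
    (G : Multiset (UserConstraint 𝓛 Sig Var)) (V : Set Var) :
    State.cls CT ⟨G, B, V⟩ = State.cls CT ⟨G.map (UserConstraint.subst x t), B, V⟩ := by
  have key (fixed : Set Var) : StoreEquiv CT fixed B (.eq (.var x) t :: B) :=
    storeEquiv_of_forall_iff fun M ν => by
      rw [List.forall_mem_cons]
      exact ⟨fun hB => ⟨h M ν hB, hB⟩, And.right⟩
  rw [cls_eq_of_storeEquiv (key _)]
  refine Eq.trans ?_ (cls_eq_of_storeEquiv (key _)).symm
  exact Quotient.sound (.rel _ _ (.subst G x t B V))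

open Classical in
-- The variables are substituted one at a time. As no `θ x` contains a variable of `xs`, later
-- substitutions do not affect terms already inserted, and the result is simultaneous.
theorem cls_substAll_of_entails {B : List (BuiltIn 𝓛 Var)} {θ : Var → 𝓛.Term Var} (xs : List Var)
    (hxs : ∀ x ∈ xs, ∀ y ∈ termVars (θ x), y ∉ xs)
    (h : ∀ (M : Theory.ModelType.{u, v, max u v} CT.theory) (ν : Var → M),
      (∀ c ∈ B, c.Holds ν) → ∀ x ∈ xs, ν x = (θ x).realize ν)
    (G : Multiset (UserConstraint 𝓛 Sig Var)) (V : Set Var) :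
    State.cls CT ⟨G, B, V⟩ = State.cls CT
      ⟨G.map (UserConstraint.substAll fun y => if y ∈ xs then θ y else .var y), B, V⟩ := by
  induction xs with
  | nil =>
    congr 2
    simp only [List.not_mem_nil, if_false]
    conv_lhs => rw [← Multiset.map_id G]
    exact Multiset.map_congr rfl fun c _ => c.substAll_var.symm
  | cons x xs ih =>
    rw [ih (fun z hz y hy hy' => hxs z (List.mem_cons_of_mem _ hz) y hy
        (List.mem_cons_of_mem _ hy'))
      (fun M ν hB z hz => h M ν hB z (List.mem_cons_of_mem _ hz)),
      cls_subst_of_entails (x := x) (t := θ x) fun M ν hB => h M ν hB x List.mem_cons_self,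
      Multiset.map_map]
    congr 2
    refine Multiset.map_congr rfl fun c _ => ?_
    simp only [Function.comp_apply, UserConstraint.subst, UserConstraint.substAll, termSubst,
      subst_subst]
    congr 1
    funext i
    congr 1
    funext y
    by_cases hy : y ∈ xs
    · rw [if_pos hy, if_pos (List.mem_cons_of_mem _ hy)]
      conv_rhs => rw [← subst_var (θ y)]
      refine subst_congr _ fun z hz => ?_
      refine Function.update_of_ne ?_ _ _
      rintro rfl
      exact hxs y (List.mem_cons_of_mem _ hy) z hz List.mem_cons_self
    · rw [if_neg hy]
      simp only [Term.subst]
      by_cases hyx : y = x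
      · subst hyx
        rw [Function.update_self, if_pos List.mem_cons_self]
      · rw [Function.update_of_ne hyx, if_neg (by simp [hyx, hy])]

/-- A store that is equivalent to a solved form `⋀ x = θ x` can be eliminated. -/
theorem cls_eq_of_solved {B : List (BuiltIn 𝓛 Var)} {θ : Var → 𝓛.Term Var} (xs : List Var)
    (hxs : ∀ x ∈ xs, ∀ y ∈ termVars (θ x), y ∉ xs)
    (h : ∀ (M : Theory.ModelType.{u, v, max u v} CT.theory) (ν : Var → M),
      (∀ c ∈ B, c.Holds ν) ↔ ∀ x ∈ xs, ν x = (θ x).realize ν)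
    {G : Multiset (UserConstraint 𝓛 Sig Var)} (hG : ∀ y ∈ goalVars G, y ∉ xs → θ y = .var y) :
    State.cls CT ⟨G, B, ∅⟩ = State.cls CT ⟨G.map (UserConstraint.substAll θ), [], ∅⟩ := by
  classical
  have hmap : G.map (UserConstraint.substAll θ) =
      G.map (UserConstraint.substAll fun y => if y ∈ xs then θ y else .var y) :=
    Multiset.map_congr rfl fun c hc => c.substAll_congr fun y hy => by
      split_ifs with hy'
      · rfl
      · exact hG y ⟨c, hc, hy⟩ hy'
  rw [hmap, cls_substAll_of_entails xs hxs fun M ν => (h M ν).1]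
  -- After the substitution no variable of `xs` occurs in the goal, so any valuation can be changed
  -- on `xs` to satisfy the equations.
  refine cls_eq_of_storeEquiv fun M ν => ⟨fun _ => ⟨ν, fun _ _ => rfl, by simp⟩, fun _ => ?_⟩
  let ν' : Var → M := fun y => if y ∈ xs then (θ y).realize ν else ν y
  refine ⟨ν', ?_, (h M ν').2 fun x hx => ?_⟩
  · rintro y (hy | ⟨c, hc, hy⟩)
    · exact hy.elim
    · refine if_neg fun hyxs => ?_
      obtain ⟨c, -, rfl⟩ := Multiset.mem_map.1 hc
      obtain ⟨i, hi⟩ := Set.mem_iUnion.1 hy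
      obtain ⟨x, -, hx⟩ := mem_termVars_subst.1 hi
      split_ifs at hx with hxx
      · exact hxs x hxx y hx hyxs
      · obtain rfl : y = x := hx
        exact hxx hyxs
  · rw [show ν' x = _ from if_pos hx]
    exact realize_congr _ fun y hy => (if_neg (hxs x hx y hy)).symm

end Solved

/-! ### Transformation steps are CHR steps -/

section Simulation

variable {𝓛 : FirstOrder.Language.{u, v}} {Var : Type w} {TG : Graph} {CT : ConstraintTheory 𝓛}
  {p : Rule TG}

/-- Finiteness allows fresh names for all variables of a rule at once, and lists of equations for
them. -/
instance RuleVar.finite : Finite (RuleVar p) := by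
  let f : RuleVar p → (p.L.V ⊕ p.L.E) ⊕ p.R.V ⊕ p.R.E ⊕ p.L.V ⊕ p.K.V ⊕ p.K.V
    | .ofL x => .inl x
    | .newNode x _ => .inr (.inl x)
    | .newEdge x _ => .inr (.inr (.inl x))
    | .dvar x => .inr (.inr (.inr (.inl x)))
    | .node' x => .inr (.inr (.inr (.inr (.inl x))))
    | .dvar' x => .inr (.inr (.inr (.inr (.inr x))))
  refine Finite.of_injective f ?_
  intro x y h
  cases x <;> cases y <;> simp_all [f]

theorem RuleVar.ofR_injOn {x y : p.R.V ⊕ p.R.E} (hx : (ofR p x).IsBody)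
    (h : ofR p x = ofR p y) : x = y := by
  have hy := h ▸ hx
  rcases x with x | x <;> rcases y with y | y <;> simp only [ofR] at hx hy h <;>
    split_ifs at hx hy h <;> simp_all [IsBody]

open Classical in
/-- The constraints of the items of `D` outside of `K`. -/
noncomputable def contextGoal (CT : ConstraintTheory 𝓛) {K D : TypedGraph TG} (k : K ⟶ D)
    (var : D.V ⊕ D.E → Var) : Multiset (UserConstraint 𝓛 (graphSig TG) Var) :=
  (Finset.univ.filter fun x => x ∉ Set.range (homV k)).val.map (chrGnd CT D var) +
    (Finset.univ.filter fun e => e ∉ Set.range (homE k)).val.map (chrEdge D var)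

theorem map_atom_contextGoal {A : Type*} (h : 𝓛.Term Var → A) {K D : TypedGraph TG} (k : K ⟶ D)
    (var : D.V ⊕ D.E → Var) :
    (contextGoal CT k var).map (UserConstraint.atom h) =
      contextAtoms (fun z => h (CT.num z).term) k (fun x => h (.var (var (.inl x))))
        fun e => h (.var (var (.inr e))) := by
  classical
  simp only [contextGoal, contextAtoms, Multiset.map_add, Multiset.map_map, sum_singleton]
  congr 1
  · refine (map_filter_univ _ _).trans ?_
    congr 1
    funext x; exact atom_nodeC ..
  · refine (map_filter_univ _ _).trans ?_
    congr 1
    funext x; exact atom_edgeC ..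

theorem goalVars_contextGoal {K D : TypedGraph TG} (k : K ⟶ D) (var : D.V ⊕ D.E → Var) :
    goalVars (contextGoal CT k var) ⊆ Set.range var := by
  classical
  intro v h
  rw [mem_goalVars_iff, map_atom_contextGoal, contextAtoms] at h
  obtain ⟨α, hα, h⟩ := h
  simp only [Multiset.mem_add, Multiset.mem_sum, Finset.mem_univ, true_and,
    Multiset.mem_singleton] at hα
  rcases hα with ⟨x, rfl⟩ | ⟨x, rfl⟩
  · rw [exists_mem_nodeAtom, termVars_constant] at h
    exact ⟨_, (h.resolve_right id).symm⟩
  · rw [exists_mem_edgeAtom] at h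
    rcases h with h | h | h <;> exact ⟨_, h.symm⟩

/-- The copies of preserved nodes and their degree variables. -/
def RuleVar.IsPrimed : RuleVar p → Prop
  | .node' _ => True
  | .dvar' _ => True
  | _ => False

theorem map_atom_substAll {A : Type*} {Sig : Signature} (h : 𝓛.Term Var → A)
    (θ : Var → 𝓛.Term Var) (G : Multiset (UserConstraint 𝓛 Sig Var)) :
    (G.map (UserConstraint.substAll θ)).map (UserConstraint.atom h) =
      G.map (UserConstraint.atom fun t => h (t.subst θ)) := by
  rw [Multiset.map_map]; rfl

end Simulation

/-! ### Solved forms for a single transformation step -/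

section Simulation

variable {𝓛 : FirstOrder.Language.{u, v}} {Var : Type w} {TG : Graph} {CT : ConstraintTheory 𝓛}
  {p : Rule TG}

/-- The variables that represent the items of a transformation in the host graphs. -/
def RuleVar.hostVar {G : TypedGraph TG} (m : p.L ⟶ G) (var : G.V ⊕ G.E → Var)
    (fr : RuleVar p → Var) : RuleVar p → Var
  | .ofL x => var (Sum.map (homV m) (homE m) x)
  | y => fr y

/-- The terms that represent the variables of a rule in the host graphs. -/
noncomputable def RuleVar.hostTerm {G H : TypedGraph TG} (CT : ConstraintTheory 𝓛) (m : p.L ⟶ G)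
    (n : p.R ⟶ H) (var : G.V ⊕ G.E → Var) (fr : RuleVar p → Var) : RuleVar p → 𝓛.Term Var
  | .dvar x => (CT.num (G.deg (homV m x))).term
  | .dvar' x => (CT.num (H.deg (homV n (homV p.r x)))).term
  | .node' x => .var (var (.inl (homV m (homV p.l x))))
  | y => .var (hostVar m var fr y)

theorem RuleVar.hostTerm_ofR {G H : TypedGraph TG} (m : p.L ⟶ G) (n : p.R ⟶ H)
    (var : G.V ⊕ G.E → Var) (fr : RuleVar p → Var) (x : p.R.V ⊕ p.R.E) :
    hostTerm CT m n var fr (ofR p x) = .var (hostVar m var fr (ofR p x)) := by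
  rcases x with x | x <;> rw [ofR] <;> split_ifs <;> rfl

theorem RuleVar.termVars_hostTerm {G H : TypedGraph TG} (m : p.L ⟶ G) (n : p.R ⟶ H)
    (var : G.V ⊕ G.E → Var) (fr : RuleVar p → Var) {y : RuleVar p} (hy : y.IsHead ∨ y.IsPrimed) :
    termVars (hostTerm CT m n var fr y) ⊆ Set.range var := by
  intro v hv
  match y, hy with
  | .ofL x, _ => exact ⟨_, Eq.symm hv⟩
  | .dvar x, _ => simp [hostTerm, termVars_constant] at hv
  | .dvar' x, _ => simp [hostTerm, termVars_constant] at hv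
  | .node' x, _ => exact ⟨_, Eq.symm hv⟩
  | .newNode .., h => exact (h.elim id id).elim
  | .newEdge .., h => exact (h.elim id id).elim

theorem RuleVar.hostTerm_of_isBody {G H : TypedGraph TG} (m : p.L ⟶ G) (n : p.R ⟶ H)
    (var : G.V ⊕ G.E → Var) (fr : RuleVar p → Var) {y : RuleVar p} (hy : y.IsBody)
    (hy' : ¬ y.IsPrimed) : hostTerm CT m n var fr y = .var (fr y) := by
  match y, hy, hy' with
  | .newNode .., _, _ => rfl
  | .newEdge .., _, _ => rfl
  | .node' .., _, h => exact (h trivial).elim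
  | .dvar' .., _, h => exact (h trivial).elim

variable {G H D : TypedGraph TG} {m : p.L ⟶ G} {k : p.K ⟶ D} {f : D ⟶ G}
  {n : p.R ⟶ H} {g : D ⟶ H}

/-- The variables of the items of the transformed graph. -/
theorem exists_hostVar (hL : IsGluedSquare p.l k m f) (hR : IsGluedSquare p.r k n g)
    (var : G.V ⊕ G.E ↪ Var) {fr : RuleVar p → Var} (hfr : Function.Injective fr)
    (hfr' : ∀ y z, fr y ≠ var z) :
    ∃ var' : H.V ⊕ H.E ↪ Var,
      (∀ d, var' (Sum.map (homV g) (homE g) d) = var (Sum.map (homV f) (homE f) d)) ∧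
      ∀ x, var' (Sum.map (homV n) (homE n) x) = RuleVar.hostVar m var fr (RuleVar.ofR p x) := by
  let w : p.R.V ⊕ p.R.E → Var := fun x => RuleVar.hostVar m var fr (RuleVar.ofR p x)
  have compV (x) : w (.inl (homV p.r x)) = var (.inl (homV f (homV k x))) := by
    rw [← hL.commV]
    exact congrArg (RuleVar.hostVar m var fr) (RuleVar.ofR_inl p x)
  have compE (x) : w (.inr (homE p.r x)) = var (.inr (homE f (homE k x))) := by
    rw [← hL.commE]
    exact congrArg (RuleVar.hostVar m var fr) (RuleVar.ofR_inr p x)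
  let var' : H.V ⊕ H.E → Var := Sum.elim
    (hR.gluingV.desc (fun x => w (.inl x)) fun d => var (.inl (homV f d)))
    (hR.gluingE.desc (fun x => w (.inr x)) fun d => var (.inr (homE f d)))
  have hg (d) : var' (Sum.map (homV g) (homE g) d) = var (Sum.map (homV f) (homE f) d) := by
    rcases d with d | d
    · exact hR.gluingV.desc_left (fun x => w (.inl x)) (fun d => var (.inl (homV f d))) d
    · exact hR.gluingE.desc_left (fun x => w (.inr x)) (fun d => var (.inr (homE f d))) d
  have hn (x) : var' (Sum.map (homV n) (homE n) x) = w x := by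
    rcases x with x | x
    · exact hR.gluingV.desc_right (a := fun x => w (.inl x))
        (b := fun d => var (.inl (homV f d))) hR.commV compV x
    · exact hR.gluingE.desc_right (a := fun x => w (.inr x))
        (b := fun d => var (.inr (homE f d))) hR.commE compE x
  -- An item of `H` either comes from `D` and keeps its variable from `G`, or is created and named
  -- by `fr`, whose range avoids the variables of `G`. Injectivity follows by cases.
  have hcases (z) : (∃ d, z = Sum.map (homV g) (homE g) d) ∨
      ∃ x, (RuleVar.ofR p x).IsBody ∧ w x = fr (RuleVar.ofR p x) ∧
        z = Sum.map (homV n) (homE n) x := by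
    rcases z with z | z
    · rcases hR.gluingV.cases z with ⟨d, rfl⟩ | ⟨x, hx, rfl⟩
      · exact .inl ⟨.inl d, rfl⟩
      · refine .inr ⟨.inl x, ?_, ?_, rfl⟩
        · rw [RuleVar.ofR_inl_of_notMem p hx]; trivial
        · simp only [w, RuleVar.ofR_inl_of_notMem p hx]; rfl
    · rcases hR.gluingE.cases z with ⟨d, rfl⟩ | ⟨x, hx, rfl⟩
      · exact .inl ⟨.inr d, rfl⟩
      · refine .inr ⟨.inr x, ?_, ?_, rfl⟩
        · rw [RuleVar.ofR_inr_of_notMem p hx]; trivial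
        · simp only [w, RuleVar.ofR_inr_of_notMem p hx]; rfl
  have hf : Function.Injective (Sum.map (homV f) (homE f)) :=
    hL.gluingV.injective.sumMap hL.gluingE.injective
  refine ⟨⟨var', fun y z hyz => ?_⟩, hg, hn⟩
  rcases hcases y with ⟨d, rfl⟩ | ⟨x, hx, hwx, rfl⟩ <;>
    rcases hcases z with ⟨d', rfl⟩ | ⟨x', hx', hwx', rfl⟩
  · rw [hg, hg] at hyz
    rw [hf (var.injective hyz)]
  · rw [hg, hn, hwx'] at hyz
    exact (hfr' _ _ hyz.symm).elim
  · rw [hg, hn, hwx] at hyz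
    exact (hfr' _ _ hyz).elim
  · rw [hn, hn, hwx, hwx'] at hyz
    rw [RuleVar.ofR_injOn hx (hfr hyz)]

theorem exists_chrStep_of_dpo [Infinite Var] (name : RuleVar p ↪ Var)
    (hL : IsGluedSquare p.l k m f) (hR : IsGluedSquare p.r k n g) (var : G.V ⊕ G.E ↪ Var)
    {P : Set (CHRRule 𝓛 (graphSig TG) Var)} (hP : encodeRule CT p name ∈ P) :
    ∃ var' : H.V ⊕ H.E ↪ Var, CHRStep CT P (State.cls CT ⟨chrHost CT G var, [], ∅⟩)
      (State.cls CT ⟨chrHost CT H var', [], ∅⟩) := by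
  classical
  have := Fintype.ofFinite (RuleVar p)
  obtain ⟨fr, hfr, hfr'⟩ := exists_injective_notMem_range (B := RuleVar p) var
  obtain ⟨var', hvar'_g, hvar'_n⟩ := exists_hostVar hL hR var hfr hfr'
  let ρ : Var → Var := Function.extend name fr id
  have hρ (y) : ρ (name y) = fr y := name.injective.extend_apply _ _ _
  let t : RuleVar p → 𝓛.Term Var := RuleVar.hostTerm CT m n var fr
  let θ : Var → 𝓛.Term Var := Function.extend fr t Term.var
  have hθ_fr (y) : θ (fr y) = t y := hfr.extend_apply _ _ _
  have hθ_var (z) : θ (var z) = .var (var z) :=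
    Function.extend_apply' _ _ _ fun ⟨y, hy⟩ => hfr' y z hy
  set r := (encodeRule CT p name).rename ρ with hr
  have hkept : r.kept = 0 := rfl
  have hguard : r.guard = [] := rfl
  have hhead : r.headVars = fr '' {y | y.IsHead} := by
    rw [hr, CHRRule.headVars_rename, headVars_encodeRule, Set.image_image]
    simp only [hρ]
  have hvars : r.vars = fr '' {y | y.IsHead ∨ y.IsBody} := by
    rw [hr, CHRRule.vars_rename, vars_encodeRule, Set.image_image]
    simp only [hρ]
  let heads : List (RuleVar p) := (Finset.univ.filter RuleVar.IsHead).toList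
  let solved : List (RuleVar p) :=
    (Finset.univ.filter fun y => RuleVar.IsHead y ∨ RuleVar.IsPrimed y).toList
  have mem_heads (y) : y ∈ heads ↔ y.IsHead := by simp [heads]
  have mem_solved (y) : y ∈ solved ↔ y.IsHead ∨ y.IsPrimed := by simp [solved]
  -- Each head variable is bound to a variable of `G` or to a degree constant. Freshness permits
  -- this, as it keeps only the body variables out of the store.
  let B : List (BuiltIn 𝓛 Var) := heads.map fun y => .eq (.var (fr y)) (t y)
  let T := contextGoal CT k (fun d => var (Sum.map (homV f) (homE f) d))
  have hTvars : goalVars T ⊆ Set.range var :=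
    (goalVars_contextGoal k _).trans (by rintro _ ⟨d, rfl⟩; exact ⟨_, rfl⟩)
  have hBholds (M : Theory.ModelType.{u, v, max u v} CT.theory) (ν : Var → M) :
      (∀ c ∈ B, c.Holds ν) ↔ ∀ y : RuleVar p, y.IsHead → ν (fr y) = (t y).realize ν := by
    simp [B, mem_heads, BuiltIn.Holds]
  have hfresh : r.Fresh T B ∅ := by
    constructor
    · rw [hvars, Set.union_empty, Set.disjoint_left]
      rintro _ ⟨y, -, rfl⟩ hv
      obtain ⟨z, hz⟩ := hTvars hv
      exact hfr' y z hz.symm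
    · rw [hvars, hhead, Set.disjoint_left]
      rintro _ ⟨⟨y, -, rfl⟩, hy⟩ ⟨c, hc, hv⟩
      obtain ⟨z, hz, rfl⟩ := List.mem_map.1 hc
      rw [mem_heads] at hz
      rcases hv with hv | hv
      · exact hy ⟨z, hz, Eq.symm hv⟩
      · obtain ⟨x, hx⟩ := RuleVar.termVars_hostTerm m n var fr (.inl hz) hv
        exact hfr' y x hx.symm
  have hTθ : T.map (UserConstraint.atom fun s => s.subst θ) =
      contextAtoms (fun z => (CT.num z).term) k
        (fun d => .var (var (.inl (homV f d)))) fun d => .var (var (.inr (homE f d))) := by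
    rw [map_atom_contextGoal]
    simp only [subst_constant, Term.subst, hθ_var]
    rfl
  have termvars_t {y : RuleVar p} (hy : y.IsHead ∨ y.IsPrimed) (z) : fr z ∉ termVars (t y) := by
    intro hv
    obtain ⟨x, hx⟩ := RuleVar.termVars_hostTerm m n var fr hy hv
    exact hfr' z x hx.symm
  refine ⟨var', _, hP, r, ⟨ρ, ?_, rfl⟩, T, B, ∅, hfresh, ?_, ?_⟩
  · rw [vars_encodeRule]
    rintro _ ⟨y, -, rfl⟩ _ ⟨z, -, rfl⟩ hyz
    rw [hρ, hρ] at hyz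
    rw [hfr hyz]
  · rw [hkept, hguard, zero_add, List.nil_append]
    refine Eq.trans ?_ (cls_eq_of_solved (θ := θ) (heads.map fr) ?_ ?_ ?_).symm
    · congr 2
      refine Multiset.map_injective UserConstraint.atom_id_injective ?_
      rw [map_atom_substAll, Multiset.map_add, map_atom_chrHost]
      simp only [id_eq]
      rw [hTθ, hr, map_atom_rename_removed]
      simp only [subst_constant, Term.subst, hρ, hθ_fr]
      exact hostAtoms_eq_headAtoms_add (idV := fun x => Term.var (var (.inl x)))
        (idE := fun x => Term.var (var (.inr x))) hL (fun _ => rfl) (fun _ => rfl) fun _ => rfl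
    · intro x hx y hy hy'
      obtain ⟨x, hx', rfl⟩ := List.mem_map.1 hx
      obtain ⟨y, -, rfl⟩ := List.mem_map.1 hy'
      rw [hθ_fr] at hy
      exact termvars_t (.inl ((mem_heads x).1 hx')) y hy
    · intro M ν
      rw [hBholds]
      simp [mem_heads, hθ_fr]
    · rintro y ⟨c, hc, hy⟩ hyx
      rcases Multiset.mem_add.1 hc with hc | hc
      · have : y ∈ r.headVars := .inl (.inr ⟨c, hc, hy⟩)
        rw [hhead] at this
        obtain ⟨y, hy₁, rfl⟩ := this
        exact (hyx (List.mem_map.2 ⟨y, (mem_heads y).2 hy₁, rfl⟩)).elim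
      · obtain ⟨z, rfl⟩ := hTvars ⟨c, hc, hy⟩
        exact hθ_var z
  · rw [hkept, hguard, zero_add, List.nil_append]
    refine Eq.trans ?_ (cls_eq_of_solved (θ := θ) (solved.map fr) ?_ ?_ ?_).symm
    · congr 2
      refine Multiset.map_injective UserConstraint.atom_id_injective ?_
      rw [map_atom_substAll, Multiset.map_add, map_atom_chrHost]
      simp only [id_eq]
      rw [hTθ, hr, map_atom_rename_bodyU]
      simp only [subst_constant, Term.subst, hρ, hθ_fr]
      rw [hostAtoms_eq_bodyAtoms_add (a := t) hR]
      · congr 1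
        congr 1
        · funext d; exact congrArg Term.var (hvar'_g (.inl d))
        · funext d; exact congrArg Term.var (hvar'_g (.inr d))
      · intro x
        rw [show t _ = _ from RuleVar.hostTerm_ofR m n var fr _, ← hvar'_n]
        rfl
      · intro x
        rw [show t _ = _ from RuleVar.hostTerm_ofR m n var fr _, ← hvar'_n]
        rfl
      · intro x
        have h₁ := hvar'_g (.inl (homV k x))
        change _ = var (.inl (homV f (homV k x))) at h₁
        rw [← hL.commV] at h₁
        change Term.var (var (.inl (homV m (homV p.l x)))) = _
        rw [← h₁, hR.commV]
        rfl
      · exact fun _ => rfl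
    · intro x hx y hy hy'
      obtain ⟨x, hx', rfl⟩ := List.mem_map.1 hx
      obtain ⟨y, -, rfl⟩ := List.mem_map.1 hy'
      rw [hθ_fr] at hy
      exact termvars_t ((mem_solved x).1 hx') y hy
    · intro M ν
      simp only [List.forall_mem_append, hBholds, List.forall_mem_map, hθ_fr, mem_solved]
      rw [hr, store_holds_rename_bodyB, store_holds_bodyB]
      simp only [Function.comp_apply, hρ]
      -- The head equations turn `dvar` into the degree in `G`; evaluating the rule's arithmetic
      -- then gives the degree in `H`, so the equation for `dvar'` becomes solved.
      have hdvar' (h : ∀ y : RuleVar p, y.IsHead → ν (fr y) = (t y).realize ν) (x : p.K.V) :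
          Structure.funMap CT.add
            ![Structure.funMap CT.sub ![ν (fr (.dvar (homV p.l x))),
              ((CT.num (p.L.deg (homV p.l x)) : 𝓛.Constants) : M)],
              ((CT.num (p.R.deg (homV p.r x)) : 𝓛.Constants) : M)] =
            (t (.dvar' x)).realize ν := by
        rw [h (.dvar (homV p.l x)) ⟨x, rfl⟩]
        simp only [t, RuleVar.hostTerm, Term.realize_constants]
        rw [ConstraintTheory.funMap_sub, ConstraintTheory.funMap_add, ← deg_transform hL hR]
      constructor
      · rintro ⟨h₁, h₂⟩ y (hy | hy)
        · exact h₂ y hy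
        · match y, hy with
          | .node' x, _ => exact (h₁ x).1.symm.trans (h₂ _ trivial)
          | .dvar' x, _ => exact (h₁ x).2.trans (hdvar' h₂ x)
      · intro h
        refine ⟨fun x => ⟨?_, ?_⟩, fun y hy => h y (.inl hy)⟩
        · exact (h (.ofL _) (.inl trivial)).trans (h (.node' x) (.inr trivial)).symm
        · exact (h (.dvar' x) (.inr trivial)).trans (hdvar' (fun y hy => h y (.inl hy)) x).symm
    -- The unsolved variables of the goal name created items or items of the context, and `θ` fixes
    -- both.
    · rintro y ⟨c, hc, hy⟩ hyx
      rcases Multiset.mem_add.1 hc with hc | hc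
      · have : y ∈ r.vars := .inl (.inr ⟨c, hc, hy⟩)
        rw [hvars] at this
        obtain ⟨y, hy₁, rfl⟩ := this
        have hy' : ¬ (y.IsHead ∨ y.IsPrimed) := fun h =>
          hyx (List.mem_map.2 ⟨y, (mem_solved y).2 h, rfl⟩)
        rw [hθ_fr]
        exact RuleVar.hostTerm_of_isBody m n var fr (hy₁.resolve_left fun h => hy' (.inl h))
          fun h => hy' (.inr h)
      · obtain ⟨z, rfl⟩ := hTvars ⟨c, hc, hy⟩
        exact hθ_var z

theorem GTS.Step.exists_chrStep [Infinite Var] {S : GTS} {G H : TypedGraph S.TG}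
    (h : S.Step G H) (name : ∀ p : Rule S.TG, RuleVar p ↪ Var) (var : G.V ⊕ G.E ↪ Var) :
    ∃ var' : H.V ⊕ H.E ↪ Var, CHRStep CT (S.toCHR CT name)
      (State.cls CT ⟨chrHost CT G var, [], ∅⟩) (State.cls CT ⟨chrHost CT H var', [], ∅⟩) := by
  obtain ⟨p, hp, m, hm, D, k, n, f, g, hL, hR⟩ := h
  have hL := IsGluedSquare.of_isPushout_of_right p.l_inj hm hL
  have hR := IsGluedSquare.of_isPushout_of_top p.r_inj hL.top_inj hR
  exact exists_chrStep_of_dpo (name p) hL hR var ⟨p, hp, rfl⟩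

/-- Along the derivation, each class is represented by an encoding with empty store; only the choice
of the variables changes from step to step. -/
theorem GTerminating.terminating [Infinite Var] {S : GTS}
    {name : ∀ p : Rule S.TG, RuleVar p ↪ Var} (h : GTerminating CT (S.toCHR CT name)) :
    S.Terminating := by
  rintro ⟨G, hG⟩
  obtain ⟨var, hvar, -⟩ := exists_injective_notMem_range (B := (G 0).V ⊕ (G 0).E) (C := Empty)
    (X := Var) Empty.elim
  let σ : State 𝓛 (graphSig S.TG) Var := ⟨chrHost CT (G 0) var, [], ∅⟩
  have hσ : GraphInvariant CT σ :=
    ⟨by simp [σ], G 0, ⟨var, hvar⟩, [], by simp, rfl⟩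
  obtain ⟨s, hs⟩ := exists_seq (s := G) (x₀ := σ.cls CT)
    (P := fun G q => ∃ var : G.V ⊕ G.E ↪ Var, q = State.cls CT ⟨chrHost CT G var, [], ∅⟩)
    (R := CHRStep CT (S.toCHR CT name)) ⟨⟨var, hvar⟩, rfl⟩ (by
      rintro i _ ⟨var, rfl⟩
      obtain ⟨var', h'⟩ := (hG i).exists_chrStep name var
      exact ⟨_, h', var', rfl⟩)
  exact h σ hσ ⟨s, hs⟩

end Simulation

end GTSCHR

theorem mainTheorem4 {𝓛 : FirstOrder.Language.{u, v}} (CT : GTSCHR.ConstraintTheory 𝓛)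
    {Var : Type w} [Infinite Var] (S : GTSCHR.GTS)
    (name : ∀ p : GTSCHR.Rule S.TG, GTSCHR.RuleVar p ↪ Var) :
    S.Terminating ↔ GTSCHR.GTerminating CT (GTSCHR.GTS.toCHR CT S name) :=
  ⟨fun h => h.gTerminating name, fun h => h.terminating⟩
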